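/- Let $(S,\mathfrak n,\mathbf k)$ be a complete regular local ring and let $d\ge 2$ be an integer. Assume that $\mathbf k=S/\mathfrak n$ is algebraically closed and that its characteristic does not divide $d$. Let $0\ne f\in\mathfrak n^2$. A matrix factorization of $f$ with $d$ factors is a $d$-tuple $(\varphi_1:F_2\to F_1,\ \varphi_2:F_3\to F_2,\ \dots,\ \varphi_d:F_1\to F_d)$ of homomorphisms between finitely generated free $S$-modules of the same rank such that $\varphi_1\varphi_2\cdots\varphi_d=f\cdot 1_{F_1}$. An isomorphism $(\varphi_i)\cong(\varphi_i')$ is a family of isomorphisms $\alpha_i:F_i\to F_i'$ with $\alpha_i\varphi_i=\varphi_i'\alpha_{i+1}$ for all $i$ (indices modulo $d$), direct sums are formed componentwise, and a matrix factorization is indecomposable if it is nonzero and not isomorphic to a direct sum of two nonzero ones. A finitely generated module over a local ring $A$ is maximal Cohen–Macaulay if its depth equals the Krull dimension of $A$, and $A$ has finite Cohen–Macaulay type if there are, up to isomorphism, only finitely many indecomposable maximal Cohen–Macaulay $A$-modules. Then there are, up to isomorphism, only finitely many indecomposable matrix factorizations of $f$ with $d$ factors if and only if the $d$-fold branched cover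 $R^\sharp=S[[z]]/(f+z^d)$ of $S/(f)$ has finite Cohen–Macaulay type. -/

import Mathlib

open IsLocalRing

universe u

/-! ## Maximal Cohen-Macaulay modules over a local ring -/

section CohenMacaulay

variable (A : Type u) [CommRing A] [IsLocalRing A]

/-- The depth of a module `M` over a local ring `A`: the supremum of the lengths of the
`M`-regular sequences contained in the maximal ideal. (Only used for `M ≠ 0`.) -/
noncomputable def moduleDepth (M : Type u) [AddCommGroup M] [Module A M] : ℕ∞ :=
  ⨆ (rs : List A) (_ : (∀ r ∈ rs, r ∈ maximalIdeal A) ∧ RingTheory.Sequence.IsRegular M rs),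
    (rs.length : ℕ∞)

/-- Nonzero maximal Cohen-Macaulay modules: finitely generated modules whose depth is the Krull
dimension of the ring. -/
def IsMCM (M : Type u) [AddCommGroup M] [Module A M] : Prop :=
  Module.Finite A M ∧ Nontrivial M ∧ (moduleDepth A M : WithBot ℕ∞) = ringKrullDim A

/-- `M` is an indecomposable object of the category of maximal Cohen-Macaulay modules: it is
nonzero and is not a direct sum of two nonzero maximal Cohen-Macaulay modules. -/
def IsIndecomposableMCM (M : Type u) [AddCommGroup M] [Module A M] : Prop :=
  IsMCM A M ∧
    ∀ (N₁ N₂ : Type u) [AddCommGroup N₁] [Module A N₁] [AddCommGroup N₂] [Module A N₂],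
      IsMCM A N₁ → IsMCM A N₂ → IsEmpty (M ≃ₗ[A] N₁ × N₂)

/-- `A` has finite Cohen-Macaulay type: up to isomorphism there are only finitely many
indecomposable maximal Cohen-Macaulay `A`-modules. -/
def HasFiniteCMType : Prop :=
  ∃ (n : ℕ) (M : Fin n → ModuleCat.{u} A),
    (∀ i, IsIndecomposableMCM A (M i)) ∧
    ∀ (N : Type u) [AddCommGroup N] [Module A N],
      IsIndecomposableMCM A N → ∃ i, Nonempty (N ≃ₗ[A] M i)

end CohenMacaulay

/-! ## Matrix factorizations with `d` factors -/

section MatrixFactorization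

variable {S : Type u} [CommRing S] {d : ℕ}

/-- For a cyclic diagram `φ i : F (i + 1) → F i`, the endomorphism of `∏ i, F i` that applies all
`φ i` simultaneously. The `i`-th entry of its `k`-th power at `x` is
`φ i (φ (i + 1) (⋯ (φ (i + k - 1) (x (i + k)))))`. -/
def cyclicMap (F : ZMod d → Type u) [∀ i, AddCommGroup (F i)] [∀ i, Module S (F i)]
    (φ : ∀ i, F (i + 1) →ₗ[S] F i) : Module.End S (∀ i, F i) :=
  LinearMap.pi fun i => φ i ∘ₗ LinearMap.proj (i + 1)

/-- A matrix factorization of `f` with `d` factors: homomorphisms `φ i : F (i + 1) → F i`, with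
indices modulo `d`, between finitely generated free modules of the same rank, such that
`φ 1 ∘ φ 2 ∘ ⋯ ∘ φ d = f • id` on `F 1`. -/
structure MatFac (S : Type u) [CommRing S] (d : ℕ) (f : S) where
  /-- the free modules -/
  F : ZMod d → Type u
  [addCommGroup : ∀ i, AddCommGroup (F i)]
  [module : ∀ i, Module S (F i)]
  [free : ∀ i, Module.Free S (F i)]
  [finite : ∀ i, Module.Finite S (F i)]
  finrank_eq : ∀ i j, Module.finrank S (F i) = Module.finrank S (F j)
  /-- the factors -/
  φ : ∀ i, F (i + 1) →ₗ[S] F i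
  factorization : ∀ x : ∀ i, F i, (cyclicMap F φ ^ d) x 1 = f • x 1

namespace MatFac

attribute [instance] addCommGroup module free finite

variable {f : S}

/-- An isomorphism of matrix factorizations: isomorphisms `F i ≃ F' i` that commute with the
factors. -/
structure Iso (X Y : MatFac S d f) where
  /-- the components -/
  α : ∀ i, X.F i ≃ₗ[S] Y.F i
  comm : ∀ i (x : X.F (i + 1)), α i (X.φ i x) = Y.φ i (α (i + 1) x)

/-- A matrix factorization is nonzero if its modules are not all zero. -/
def IsNonzero (X : MatFac S d f) : Prop :=
  ∃ i, Nontrivial (X.F i)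

theorem cyclicMap_prod_pow (X Y : MatFac S d f) (k : ℕ) (x : ∀ i, X.F i × Y.F i) (i : ZMod d) :
    (cyclicMap (S := S) (fun i => X.F i × Y.F i)
        (fun i => (X.φ i).prodMap (Y.φ i)) ^ k) x i =
      ((cyclicMap X.F X.φ ^ k) (fun j => (x j).1) i,
        (cyclicMap Y.F Y.φ ^ k) (fun j => (x j).2) i) := by
  induction k generalizing x with
  | zero => rfl
  | succ k ih =>
    simp only [pow_succ, Module.End.mul_apply]
    rw [ih]
    rfl

/-- The direct sum of two matrix factorizations, formed componentwise. -/
def directSum [Nontrivial S] (X Y : MatFac S d f) : MatFac S d f where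
  F i := X.F i × Y.F i
  finrank_eq i j := by
    rw [Module.finrank_prod, Module.finrank_prod, X.finrank_eq i j, Y.finrank_eq i j]
  φ i := (X.φ i).prodMap (Y.φ i)
  factorization x := by
    rw [cyclicMap_prod_pow, X.factorization, Y.factorization]
    rfl

/-- A matrix factorization is indecomposable if it is nonzero and not isomorphic to a direct sum
of two nonzero matrix factorizations. -/
def IsIndecomposable [Nontrivial S] (X : MatFac S d f) : Prop :=
  X.IsNonzero ∧
    ∀ Y Z : MatFac S d f, Y.IsNonzero → Z.IsNonzero → IsEmpty (X.Iso (Y.directSum Z))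

end MatFac

/-- `f` has finite `d`-MF type: up to isomorphism there are only finitely many indecomposable
matrix factorizations of `f` with `d` factors. -/
def HasFiniteMFType [Nontrivial S] (d : ℕ) (f : S) : Prop :=
  ∃ (n : ℕ) (X : Fin n → MatFac S d f),
    (∀ i, (X i).IsIndecomposable) ∧
    ∀ Y : MatFac S d f, Y.IsIndecomposable → ∃ i, Nonempty (Y.Iso (X i))

end MatrixFactorization

/-! ## The branched cover -/

section BranchedCover

variable {S : Type u} [CommRing S]

/-- The `d`-fold branched cover `S⟦z⟧ / (f + z ^ d)` of `S / (f)`. -/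
abbrev BranchedCover (d : ℕ) (f : S) : Type u :=
  PowerSeries S ⧸ Ideal.span {PowerSeries.C f + PowerSeries.X ^ d}

theorem branchedCover_isLocalRing [IsLocalRing S] {d : ℕ} (hd : 2 ≤ d) {f : S}
    (hf : f ∈ maximalIdeal S ^ 2) : IsLocalRing (BranchedCover d f) := by
  have hnt : Nontrivial (BranchedCover d f) := by
    rw [Ideal.Quotient.nontrivial_iff, Ne, Ideal.span_singleton_eq_top,
      PowerSeries.isUnit_iff_constantCoeff]
    have h0 : (0 : ℕ) ≠ d := by omega
    have hm : f ∈ maximalIdeal S := Ideal.pow_le_self two_ne_zero hf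
    simpa [zero_pow h0.symm] using hm
  exact IsLocalRing.of_surjective' (Ideal.Quotient.mk _) Ideal.Quotient.mk_surjective

end BranchedCover

/-! Both finiteness conditions concern diagrams of finite free `S`-modules (`CycRep`): families `φ j
: F (σ j) → F j` whose `N`-fold composites are multiplication by `f`. For `f ≠ 0`, matrix
factorizations with `d` factors are such diagrams on the cycle `ZMod d` with `N = d`
(`MatFac.hasFiniteMFType_iff`).

On the other side, `X ^ d + f` is a distinguished polynomial, so Weierstrass division makes the
branched cover `S[X]/(X ^ d + f)`, which is finite and free over `S`. Its maximal Cohen–Macaulay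
modules are therefore the nonzero modules that are finite and free over `S` (`isMCM_iff`). Such a
module is a free `S`-module with an endomorphism `z` satisfying `z ^ d = -f`. Hensel's lemma gives
`μ` in `S` with `μ ^ d = -1`, and `μ z` is then a `d`-th root of `f`: a diagram on one vertex
(`IsRootExtension.hasFiniteCMType_iff`).

Two additive functors compare the cycle with the single vertex. One repeats an endomorphism around
the cycle; the other takes the product of all the modules of a diagram with its total endomorphism.
Every cyclic diagram is a retract of the constant diagram on its total module, by coordinate
inclusion and projection. Conversely, a module with an endomorphism is a retract of the total module
of its constant diagram, by the diagonal and the average; averaging needs `d` invertible in `S`.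

It remains to pass finiteness along retracts. Endomorphism rings of diagrams are finite algebras
over the complete ring `S`, so indecomposable objects have local endomorphism rings. Idempotents
split, and ranks drop on proper retracts. Hence each object has only finitely many indecomposable
retracts up to isomorphism, and finite type descends along both functors
(`KrullSchmidt.FiniteType.of_retract`, `CycRep.finiteType_iff`). -/

/-! ## The Krull–Schmidt property in preadditive categories -/

section

open CategoryTheory Limits

universe v₁ v₂ u₁ u₂

namespace KrullSchmidt

section

variable {C : Type u₁} [Category.{v₁} C] [Preadditive C]

/-- A nonzero object whose only idempotent endomorphisms are `0` and the identity. -/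
def IsIndec (X : C) : Prop :=
  ¬ IsZero X ∧ ∀ e : X ⟶ X, e ≫ e = e → e = 0 ∨ e = 𝟙 X

variable (C) in
/-- There are only finitely many indecomposable objects up to isomorphism. -/
def FiniteType : Prop :=
  ∃ s : Set C, s.Finite ∧ ∀ X : C, IsIndec X → ∃ Y ∈ s, Nonempty (X ≅ Y)

theorem IsIndec.of_iso {X Y : C} (i : X ≅ Y) (h : IsIndec X) : IsIndec Y := by
  refine ⟨fun hY ↦ h.1 (hY.of_iso i), fun e he ↦ ?_⟩
  rcases h.2 (i.hom ≫ e ≫ i.inv) (by simp [reassoc_of% he]) with h0 | h1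
  · left
    have := congrArg (fun t ↦ i.inv ≫ t ≫ i.hom) h0
    simpa using this
  · right
    have := congrArg (fun t ↦ i.inv ≫ t ≫ i.hom) h1
    simpa using this

/-- Indecomposable objects have local endomorphism rings. -/
def LocalEnds (C : Type u₁) [Category.{v₁} C] [Preadditive C] : Prop :=
  ∀ X : C, IsIndec X → ∀ a : X ⟶ X, IsIso a ∨ IsIso (𝟙 X - a)

/-- A retract of `W`, where the identity of `W` is the sum of two endomorphisms that factor through
`A` and `B`, is a retract of `A` or of `B`, if it is indecomposable. -/
theorem retract_or_retract (hC : LocalEnds C) {X W A B : C} (hX : IsIndec X)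
    (h : Retract X W) (pA : W ⟶ A) (iA : A ⟶ W) (pB : W ⟶ B) (iB : B ⟶ W)
    (hid : pA ≫ iA + pB ≫ iB = 𝟙 W) : Nonempty (Retract X A) ∨ Nonempty (Retract X B) := by
  have hsub : 𝟙 X - h.i ≫ pA ≫ iA ≫ h.r = h.i ≫ pB ≫ iB ≫ h.r := by
    rw [sub_eq_iff_eq_add, ← h.retract]
    calc h.i ≫ h.r = h.i ≫ (pA ≫ iA + pB ≫ iB) ≫ h.r := by rw [hid, Category.id_comp]
      _ = _ := by
        rw [Preadditive.add_comp, Preadditive.comp_add, add_comm]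
        simp only [Category.assoc]
  -- The identity of `X` is the sum of one endomorphism through `A` and one through `B`; by locality
  -- one of them is invertible, which exhibits the retract.
  rcases hC X hX (h.i ≫ pA ≫ iA ≫ h.r) with h1 | h1
  · refine Or.inl ⟨⟨h.i ≫ pA, (iA ≫ h.r) ≫ inv (h.i ≫ pA ≫ iA ≫ h.r), ?_⟩⟩
    have := IsIso.hom_inv_id (h.i ≫ pA ≫ iA ≫ h.r)
    simpa only [Category.assoc] using this
  · rw [hsub] at h1
    refine Or.inr ⟨⟨h.i ≫ pB, (iB ≫ h.r) ≫ inv (h.i ≫ pB ≫ iB ≫ h.r), ?_⟩⟩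
    have := IsIso.hom_inv_id (h.i ≫ pB ≫ iB ≫ h.r)
    simpa only [Category.assoc] using this

theorem iso_of_retract {X Y : C} (hX : IsIndec X) (hY : IsIndec Y) (h : Retract X Y) :
    Nonempty (X ≅ Y) := by
  rcases hY.2 (h.r ≫ h.i) (by simp) with h0 | h1
  · refine absurd ((IsZero.iff_id_eq_zero X).2 ?_) hX.1
    calc 𝟙 X = h.i ≫ (h.r ≫ h.i) ≫ h.r := by simp
      _ = 0 := by rw [h0]; simp
  · exact ⟨⟨h.i, h.r, h.retract, h1⟩⟩

/-- Proper retracts have smaller rank. -/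
def RankMono (rank : C → ℕ) : Prop :=
  ∀ (X Y : C) (h : Retract X Y), h.r ≫ h.i ≠ 𝟙 Y → rank X < rank Y

/-- Split a nontrivial idempotent and its complement. Both images are proper retracts, so the rank
drops; this drives the inductions on rank below. -/
theorem exists_decomposition [IsIdempotentComplete C] {rank : C → ℕ} (hrank : RankMono rank)
    (Y : C) (h0 : ¬ IsZero Y) (h : ¬ IsIndec Y) :
    ∃ (A B : C) (pA : Y ⟶ A) (iA : A ⟶ Y) (pB : Y ⟶ B) (iB : B ⟶ Y),
      iA ≫ pA = 𝟙 A ∧ iB ≫ pB = 𝟙 B ∧ pA ≫ iA + pB ≫ iB = 𝟙 Y ∧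
      rank A < rank Y ∧ rank B < rank Y := by
  simp only [IsIndec, h0, not_false_eq_true, true_and, not_forall, not_or] at h
  obtain ⟨e, he, he0, he1⟩ := h
  obtain ⟨A, iA, pA, hA, hA'⟩ := IsIdempotentComplete.idempotents_split Y e he
  obtain ⟨B, iB, pB, hB, hB'⟩ := IsIdempotentComplete.idempotents_split Y (𝟙 Y - e)
    (Idempotents.idem_of_id_sub_idem e he)
  refine ⟨A, B, pA, iA, pB, iB, hA, hB, by rw [hA', hB']; abel, ?_, ?_⟩
  · exact hrank A Y ⟨iA, pA, hA⟩ (by simpa only [hA'] using he1)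
  · refine hrank B Y ⟨iB, pB, hB⟩ ?_
    rw [hB']
    exact fun h' ↦ he0 (sub_eq_self.mp h')

theorem isZero_of_retract {X Y : C} (h : Retract X Y) (hY : IsZero Y) : IsZero X := by
  rw [IsZero.iff_id_eq_zero, ← h.retract, hY.eq_of_tgt h.i 0, zero_comp]

/-- Up to isomorphism, an object has only finitely many indecomposable retracts. -/
theorem finite_indec_retracts [IsIdempotentComplete C] (hC : LocalEnds C) {rank : C → ℕ}
    (hrank : RankMono rank) (Y : C) :
    ∃ s : Set C, s.Finite ∧ ∀ X : C, IsIndec X → Nonempty (Retract X Y) →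
      ∃ Z ∈ s, Nonempty (X ≅ Z) := by
  induction hn : rank Y using Nat.strong_induction_on generalizing Y with
  | _ n ih =>
  subst hn
  by_cases h0 : IsZero Y
  · exact ⟨∅, Set.finite_empty, fun X hX ⟨h⟩ ↦ absurd (isZero_of_retract h h0) hX.1⟩
  by_cases hY : IsIndec Y
  · exact ⟨{Y}, Set.finite_singleton Y, fun X hX ⟨h⟩ ↦ ⟨Y, rfl, iso_of_retract hX hY h⟩⟩
  obtain ⟨A, B, pA, iA, pB, iB, -, -, hid, hrA, hrB⟩ := exists_decomposition hrank Y h0 hY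
  obtain ⟨s, hs, hs'⟩ := ih _ hrA A rfl
  obtain ⟨t, ht, ht'⟩ := ih _ hrB B rfl
  refine ⟨s ∪ t, hs.union ht, fun X hX ⟨h⟩ ↦ ?_⟩
  rcases retract_or_retract hC hX h pA iA pB iB hid with h' | h'
  · obtain ⟨Z, hZ, hXZ⟩ := hs' X hX h'
    exact ⟨Z, Or.inl hZ, hXZ⟩
  · obtain ⟨Z, hZ, hXZ⟩ := ht' X hX h'
    exact ⟨Z, Or.inr hZ, hXZ⟩

end

variable {C : Type u₁} [Category.{v₁} C] [Preadditive C] {D : Type u₂} [Category.{v₂} D]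
  [Preadditive D]

/-- An additive functor preserves the decomposition of the identity of `Y`, so `X` passes to the
image of one summand; iterate until the summand is indecomposable. -/
theorem exists_indec_retract_map [IsIdempotentComplete D] (hC : LocalEnds C) {rank : D → ℕ}
    (hrank : RankMono rank) (G : D ⥤ C) [G.Additive] {X : C} (hX : IsIndec X) (Y : D)
    (h : Retract X (G.obj Y)) : ∃ Z : D, IsIndec Z ∧ Nonempty (Retract X (G.obj Z)) := by
  induction hn : rank Y using Nat.strong_induction_on generalizing Y with
  | _ n ih =>
  subst hn
  by_cases h0 : IsZero Y
  · exact absurd (isZero_of_retract h (G.map_isZero h0)) hX.1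
  by_cases hY : IsIndec Y
  · exact ⟨Y, hY, ⟨h⟩⟩
  obtain ⟨A, B, pA, iA, pB, iB, -, -, hid, hrA, hrB⟩ := exists_decomposition hrank Y h0 hY
  rcases retract_or_retract hC hX h (G.map pA) (G.map iA) (G.map pB) (G.map iB) (by
    rw [← G.map_comp, ← G.map_comp, ← G.map_add, hid, G.map_id]) with ⟨⟨h'⟩⟩ | ⟨⟨h'⟩⟩
  · exact ih _ hrA A h' rfl
  · exact ih _ hrB B h' rfl

/-- Finite type descends along an additive functor `G` for which every object is a retract of
an object in the image of `G`. -/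
theorem FiniteType.of_retract [IsIdempotentComplete C] [IsIdempotentComplete D]
    (hC : LocalEnds C) {rankC : C → ℕ} (hrankC : RankMono rankC) {rankD : D → ℕ}
    (hrankD : RankMono rankD) (G : D ⥤ C) [G.Additive]
    (hG : ∀ X : C, ∃ Y : D, Nonempty (Retract X (G.obj Y))) (h : FiniteType D) :
    FiniteType C := by
  obtain ⟨s, hs, hs'⟩ := h
  choose t ht ht' using fun Y : C ↦ finite_indec_retracts hC hrankC Y
  refine ⟨⋃ Y ∈ s, t (G.obj Y), hs.biUnion fun Y _ ↦ ht _, fun X hX ↦ ?_⟩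
  obtain ⟨Y, ⟨hY⟩⟩ := hG X
  obtain ⟨Z, hZ, ⟨hXZ⟩⟩ := exists_indec_retract_map hC hrankD G hX Y hY
  obtain ⟨W, hW, ⟨i⟩⟩ := hs' Z hZ
  obtain ⟨V, hV, hXV⟩ := ht' (G.obj W) X hX
    ⟨⟨hXZ.i ≫ G.map i.hom, G.map i.inv ≫ hXZ.r, by simp [← G.map_comp_assoc]⟩⟩
  exact ⟨V, Set.mem_biUnion hW hV, hXV⟩

end KrullSchmidt

end

/-! ## Finite algebras over complete local rings -/

section

open IsLocalRing

section LocalEndomorphisms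

/-- The map from `M` to its completion is onto because both `R` to its completion and the comparison
from the tensor product of that completion with `M` are onto. -/
theorem isPrecomplete_of_finite {R M : Type*} [CommRing R] [AddCommGroup M] [Module R M]
    (I : Ideal R) [IsPrecomplete I R] [Module.Finite R M] : IsPrecomplete I M := by
  rw [← AdicCompletion.of_surjective_iff]
  intro x
  obtain ⟨t, rfl⟩ := AdicCompletion.ofTensorProduct_surjective_of_finite I M x
  induction t with
  | zero => exact ⟨0, by simp⟩
  | add a b ha hb =>
    obtain ⟨a', ha'⟩ := ha
    obtain ⟨b', hb'⟩ := hb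
    exact ⟨a' + b', by rw [map_add, map_add, ha', hb']⟩
  | tmul r m =>
    obtain ⟨s, rfl⟩ := AdicCompletion.of_surjective I R r
    refine ⟨s • m, ?_⟩
    rw [AdicCompletion.ofTensorProduct_tmul, map_smul]
    ext n
    rfl

variable {S : Type*} [CommRing S] [IsLocalRing S] [IsNoetherianRing S]
  [IsAdicComplete (maximalIdeal S) S]

theorem isAdicComplete_map_of_finite (A : Type*) [CommRing A] [Algebra S A] [Module.Finite S A] :
    IsAdicComplete ((maximalIdeal S).map (algebraMap S A)) A := by
  rw [IsAdicComplete.map_algebraMap_iff]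
  have := isPrecomplete_of_finite (M := A) (maximalIdeal S)
  exact {}

theorem isArtinianRing_quotient_map (S : Type*) [CommRing S] [IsLocalRing S] (A : Type*)
    [CommRing A] [Algebra S A] [Module.Finite S A] :
    IsArtinianRing (A ⧸ (maximalIdeal S).map (algebraMap S A)) := by
  let J := (maximalIdeal S).map (algebraMap S A)
  let _ : Field (S ⧸ maximalIdeal S) := Ideal.Quotient.field _
  let _ : Algebra (S ⧸ maximalIdeal S) (A ⧸ J) :=
    (Ideal.quotientMap J (algebraMap S A) Ideal.le_comap_map).toAlgebra
  have : IsScalarTower S (S ⧸ maximalIdeal S) (A ⧸ J) := IsScalarTower.of_algebraMap_eq fun _ ↦ rfl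
  have : Module.Finite (S ⧸ maximalIdeal S) (A ⧸ J) :=
    Module.Finite.of_restrictScalars_finite S _ _
  exact IsArtinianRing.of_finite (S ⧸ maximalIdeal S) (A ⧸ J)

/-- Modulo the ideal generated by the maximal ideal of `S`, the ring is Artinian, so powers of `a`
stabilize and yield a Fitting idempotent. It lifts by Hensel's lemma, hence is `0` or `1`, making
`a` nilpotent or invertible modulo that ideal. -/
theorem isUnit_or_isUnit_one_sub_of_idempotents_trivial_comm {A : Type*} [CommRing A] [Algebra S A]
    [Module.Finite S A] (h : ∀ e : A, e * e = e → e = 0 ∨ e = 1) (a : A) :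
    IsUnit a ∨ IsUnit (1 - a) := by
  set J := (maximalIdeal S).map (algebraMap S A) with hJ
  have : IsAdicComplete J A := isAdicComplete_map_of_finite A
  have : IsArtinianRing (A ⧸ J) := isArtinianRing_quotient_map S A
  have hloc : IsLocalHom (Ideal.Quotient.mk J) :=
    isLocalHom_of_le_jacobson_bot J (IsAdicComplete.le_jacobson_bot J)
  set b := Ideal.Quotient.mk J a with hb
  obtain ⟨n, y, hy⟩ := IsArtinian.exists_pow_succ_smul_dvd b (1 : A ⧸ J)
  simp only [smul_eq_mul, mul_one] at hy
  have key : ∀ k, b ^ n * (b ^ k * y ^ k) = b ^ n := by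
    intro k
    induction k with
    | zero => simp
    | succ k ih =>
      calc b ^ n * (b ^ (k + 1) * y ^ (k + 1)) = (b ^ (n + 1) * y) * (b ^ k * y ^ k) := by ring
        _ = b ^ n := by rw [hy, ih]
  set e := b ^ n * y ^ n with he
  have hee : e * e = e := by
    calc e * e = (b ^ n * (b ^ n * y ^ n)) * y ^ n := by rw [he]; ring
      _ = e := by rw [key n]
  obtain ⟨a₀, ha₀⟩ := Ideal.Quotient.mk_surjective e
  -- The idempotent is a simple root of `X ^ 2 - X`: the derivative there is `2 * e - 1`, whose
  -- square is `1`.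
  obtain ⟨E, hE, hEa⟩ := HenselianRing.is_henselian (I := J)
    (Polynomial.X ^ 2 - Polynomial.X : Polynomial A)
    (Polynomial.monic_X_pow_sub (n := 2)
      (Polynomial.degree_X_le.trans_lt (by norm_num))) a₀ (by
      rw [← Ideal.Quotient.eq_zero_iff_mem]
      simp [ha₀, pow_two, hee]) (by
      have : IsUnit (2 * e - 1) := by
        refine IsUnit.of_mul_eq_one (2 * e - 1) ?_
        linear_combination 4 * hee
      have hder : Ideal.Quotient.mk J (Polynomial.eval a₀ (Polynomial.derivative
          (Polynomial.X ^ 2 - Polynomial.X))) = 2 * e - 1 := by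
        simp [ha₀]
        ring
      rwa [hder])
  have hE' : E * E = E := by
    have : E ^ 2 - E = 0 := by simpa using hE
    linear_combination this
  rw [← Ideal.Quotient.mk_eq_mk_iff_sub_mem, ha₀] at hEa
  rcases h E hE' with rfl | rfl
  · right
    have he0 : e = 0 := by rw [← hEa, map_zero]
    have hbn : b ^ n = 0 := by rw [← key n, ← he, he0, mul_zero]
    have : IsUnit (1 - b) := IsNilpotent.isUnit_one_sub ⟨n, hbn⟩
    exact hloc.map_nonunit _ (by rwa [map_sub, map_one])
  · left
    have he1 : b ^ n * y ^ n = 1 := by rw [← he, ← hEa, map_one]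
    refine hloc.map_nonunit _ (IsUnit.of_mul_eq_one y ?_)
    calc b * y = b * y * (b ^ n * y ^ n) := by rw [he1, mul_one]
      _ = (b ^ (n + 1) * y) * y ^ n := by ring
      _ = 1 := by rw [hy, he1]

/-- A module-finite algebra over a complete noetherian local ring whose only idempotents are `0`
and `1` is local. -/
theorem isUnit_or_isUnit_one_sub_of_idempotents_trivial (S : Type*) [CommRing S] [IsLocalRing S]
    [IsNoetherianRing S] [IsAdicComplete (maximalIdeal S) S] {E : Type*} [Ring E] [Algebra S E]
    [Module.Finite S E] (h : ∀ e : E, e * e = e → e = 0 ∨ e = 1) (a : E) :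
    IsUnit a ∨ IsUnit (1 - a) := by
  -- The subalgebra generated by `a` is commutative, is finite because `S` is noetherian, and
  -- inherits the absence of nontrivial idempotents.
  let A := Algebra.adjoin S {a}
  have : IsMulCommutative A := Algebra.isMulCommutative_adjoin S (by
    rintro x rfl y rfl; rfl)
  have : Module.Finite S A := Module.IsNoetherian.finite S (Subalgebra.toSubmodule A)
  let a' : A := ⟨a, Algebra.self_mem_adjoin_singleton S a⟩
  have hA : ∀ e : A, e * e = e → e = 0 ∨ e = 1 := fun e he ↦ by
    rcases h e (congrArg Subtype.val he) with h0 | h1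
    · exact Or.inl (Subtype.ext h0)
    · exact Or.inr (Subtype.ext h1)
  rcases isUnit_or_isUnit_one_sub_of_idempotents_trivial_comm (S := S) hA a' with hu | hu
  · exact Or.inl (hu.map A.val)
  · exact Or.inr (hu.map A.val)

end LocalEndomorphisms

end

/-! ## Cyclic representations -/

section

open IsLocalRing CategoryTheory Limits

section CycRep

/-- For a diagram `φ j : F (σ j) → F j`, the endomorphism of `∏ j, F j` that applies all `φ j`
simultaneously. -/
def totalMap {S : Type u} [CommRing S] {J : Type} (σ : J → J) (F : J → Type u)
    [∀ j, AddCommGroup (F j)] [∀ j, Module S (F j)] (φ : ∀ j, F (σ j) →ₗ[S] F j) :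
    Module.End S (∀ j, F j) :=
  LinearMap.pi fun j => φ j ∘ₗ LinearMap.proj (σ j)

theorem totalMap_apply {S : Type u} [CommRing S] {J : Type} (σ : J → J) (F : J → Type u)
    [∀ j, AddCommGroup (F j)] [∀ j, Module S (F j)] (φ : ∀ j, F (σ j) →ₗ[S] F j)
    (x : ∀ j, F j) (j : J) : totalMap σ F φ x j = φ j (x (σ j)) :=
  rfl

/-- Naturality of the iterated total map; it transfers the power condition to images of idempotents
and to direct sums. -/
theorem map_totalMap_pow {S : Type u} [CommRing S] {J : Type} {σ : J → J} {F F' : J → Type u}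
    [∀ j, AddCommGroup (F j)] [∀ j, Module S (F j)] [∀ j, AddCommGroup (F' j)]
    [∀ j, Module S (F' j)] {φ : ∀ j, F (σ j) →ₗ[S] F j} {φ' : ∀ j, F' (σ j) →ₗ[S] F' j}
    (g : ∀ j, F j →ₗ[S] F' j) (hg : ∀ j x, g j (φ j x) = φ' j (g (σ j) x)) (k : ℕ)
    (x : ∀ j, F j) (j : J) :
    g j ((totalMap σ F φ ^ k) x j) = (totalMap σ F' φ' ^ k) (fun j ↦ g j (x j)) j := by
  induction k generalizing x with
  | zero => rfl
  | succ k ih =>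
    simp only [pow_succ, Module.End.mul_apply]
    rw [ih]
    exact congrArg (fun z ↦ (totalMap σ F' φ' ^ k) z j) (funext fun j ↦ hg j _)

/-- Diagrams `φ j : F (σ j) → F j` of finite free modules whose `N`-fold composites are
multiplication by `f`. -/
structure CycRep (S : Type u) [CommRing S] {J : Type} (σ : J → J) (N : ℕ) (f : S) where
  /-- the free modules -/
  F : J → Type u
  [addCommGroup : ∀ j, AddCommGroup (F j)]
  [module : ∀ j, Module S (F j)]
  [free : ∀ j, Module.Free S (F j)]
  [finite : ∀ j, Module.Finite S (F j)]
  /-- the maps -/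
  φ : ∀ j, F (σ j) →ₗ[S] F j
  pow_eq : ∀ x j, (totalMap σ F φ ^ N) x j = f • x j

namespace CycRep

attribute [instance] addCommGroup module free finite

variable {S : Type u} [CommRing S] {J : Type} {σ : J → J} {N : ℕ} {f : S}

/-- Families of linear maps that commute with the structure maps. -/
def homs (X Y : CycRep S σ N f) : Submodule S (∀ j, X.F j →ₗ[S] Y.F j) where
  carrier := {g | ∀ j x, g j (X.φ j x) = Y.φ j (g (σ j) x)}
  add_mem' {a b} ha hb j x := by simp [ha j x, hb j x]
  zero_mem' j x := by simp
  smul_mem' c a ha j x := by simp [ha j x]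

instance : Category (CycRep S σ N f) where
  Hom X Y := X.homs Y
  id X := ⟨fun _ ↦ LinearMap.id, fun _ _ ↦ rfl⟩
  comp {X Y Z} g h := ⟨fun j ↦ h.1 j ∘ₗ g.1 j, fun j x ↦ by
    simp only [LinearMap.comp_apply]; rw [g.2 j x, h.2 j]⟩

@[ext]
theorem hom_ext {X Y : CycRep S σ N f} {g h : X ⟶ Y} (H : ∀ j x, g.1 j x = h.1 j x) : g = h :=
  Subtype.ext (funext fun j ↦ LinearMap.ext (H j))

@[simp]
theorem id_val (X : CycRep S σ N f) (j : J) (x : X.F j) : (𝟙 X : X ⟶ X).1 j x = x := rfl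

@[simp]
theorem comp_val {X Y Z : CycRep S σ N f} (g : X ⟶ Y) (h : Y ⟶ Z) (j : J) (x : X.F j) :
    (g ≫ h).1 j x = h.1 j (g.1 j x) := rfl

instance (X Y : CycRep S σ N f) : AddCommGroup (X ⟶ Y) := inferInstanceAs (AddCommGroup (X.homs Y))

instance (X Y : CycRep S σ N f) : Module S (X ⟶ Y) := inferInstanceAs (Module S (X.homs Y))

@[simp]
theorem add_val {X Y : CycRep S σ N f} (g h : X ⟶ Y) (j : J) (x : X.F j) :
    (g + h).1 j x = g.1 j x + h.1 j x := rfl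

@[simp]
theorem smul_val {X Y : CycRep S σ N f} (c : S) (g : X ⟶ Y) (j : J) (x : X.F j) :
    (c • g).1 j x = c • g.1 j x := rfl

instance : Preadditive (CycRep S σ N f) where
  homGroup X Y := inferInstance
  add_comp X Y Z g g' h := by ext j x; simp
  comp_add X Y Z g g' h := by ext j x; simp

instance : Linear S (CycRep S σ N f) where
  homModule X Y := inferInstance
  smul_comp X Y Z c g h := by ext j x; simp
  comp_smul X Y Z g c h := by ext j x; simp

theorem isZero_iff (X : CycRep S σ N f) : IsZero X ↔ ∀ j, Subsingleton (X.F j) := by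
  rw [IsZero.iff_id_eq_zero]
  constructor
  · intro h j
    refine subsingleton_of_forall_eq 0 fun x ↦ ?_
    have := congrArg (fun g : X ⟶ X ↦ g.1 j x) h
    simpa using this
  · intro h
    ext j x
    exact Subsingleton.elim _ _

theorem not_isZero_iff (X : CycRep S σ N f) : ¬ IsZero X ↔ ∃ j, Nontrivial (X.F j) := by
  simp [isZero_iff, not_subsingleton_iff_nontrivial]

/-- Isomorphisms from componentwise isomorphisms. -/
def isoMk {X Y : CycRep S σ N f} (α : ∀ j, X.F j ≃ₗ[S] Y.F j)
    (h : ∀ j x, α j (X.φ j x) = Y.φ j (α (σ j) x)) : X ≅ Y where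
  hom := ⟨fun j ↦ (α j).toLinearMap, h⟩
  inv := ⟨fun j ↦ (α j).symm.toLinearMap, fun j y ↦ by
    simp [LinearEquiv.symm_apply_eq, h]⟩
  hom_inv_id := by ext j x; simp
  inv_hom_id := by ext j x; simp

/-- The components of an isomorphism. -/
def isoComponent {X Y : CycRep S σ N f} (i : X ≅ Y) (j : J) : X.F j ≃ₗ[S] Y.F j where
  toLinearMap := i.hom.1 j
  invFun := i.inv.1 j
  left_inv x := by
    change i.inv.1 j (i.hom.1 j x) = x
    rw [← comp_val, i.hom_inv_id, id_val]
  right_inv x := by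
    change i.hom.1 j (i.inv.1 j x) = x
    rw [← comp_val, i.inv_hom_id, id_val]

/-- The image of an idempotent. -/
def image [IsLocalRing S] (X : CycRep S σ N f) (e : X ⟶ X) (he : e ≫ e = e) :
    CycRep S σ N f where
  F j := LinearMap.range (e.1 j)
  free j := by
    -- The image of an idempotent is a direct summand, hence projective, hence free over the local
    -- ring.
    have : Module.Projective S (LinearMap.range (e.1 j)) :=
      Module.Projective.of_split (LinearMap.range (e.1 j)).subtype (e.1 j).rangeRestrict (by
        ext ⟨x, y, rfl⟩
        exact congrArg (fun g : X ⟶ X ↦ g.1 j y) he)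
    exact Module.free_of_flat_of_isLocalRing
  φ j := (X.φ j).restrict (by
    rintro _ ⟨y, rfl⟩
    exact ⟨X.φ j y, e.2 j y⟩)
  pow_eq x j := by
    apply Subtype.ext
    refine (map_totalMap_pow (fun j ↦ (LinearMap.range (e.1 j)).subtype) (fun _ _ ↦ rfl) N x
      j).trans ?_
    exact X.pow_eq _ j

instance [IsLocalRing S] : IsIdempotentComplete (CycRep S σ N f) where
  idempotents_split X e he := by
    refine ⟨X.image e he, ⟨fun j ↦ (LinearMap.range (e.1 j)).subtype, fun j x ↦ rfl⟩,
      ⟨fun j ↦ (e.1 j).rangeRestrict, fun j x ↦ Subtype.ext (e.2 j x)⟩, ?_, ?_⟩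
    · ext j ⟨x, y, rfl⟩
      exact Subtype.ext (congrArg (fun g : X ⟶ X ↦ g.1 j y) he)
    · ext j x
      rfl

instance [Finite J] [IsNoetherianRing S] (X Y : CycRep S σ N f) : Module.Finite S (X ⟶ Y) :=
  inferInstanceAs (Module.Finite S (X.homs Y))

theorem localEnds [IsLocalRing S] [IsNoetherianRing S] [IsAdicComplete (maximalIdeal S) S]
    [Finite J] : KrullSchmidt.LocalEnds (CycRep S σ N f) := by
  intro X hX a
  have : Module.Finite S (End X) := inferInstanceAs (Module.Finite S (X ⟶ X))
  rcases isUnit_or_isUnit_one_sub_of_idempotents_trivial S (E := End X) hX.2 a with h | h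
  · exact Or.inl ((isUnit_iff_isIso a).1 h)
  · exact Or.inr ((isUnit_iff_isIso (𝟙 X - a)).1 h)

/-- The sum of the ranks of the modules of a diagram. -/
noncomputable def rank [Fintype J] (X : CycRep S σ N f) : ℕ := ∑ j, Module.finrank S (X.F j)

/-- Components of a retraction are surjective. If the total ranks agree, so do all the componentwise
ranks, and a surjection between finite free modules of equal rank is injective; the retraction is
then an isomorphism. -/
theorem rankMono [Nontrivial S] [Fintype J] :
    KrullSchmidt.RankMono (rank : CycRep S σ N f → ℕ) := by
  intro X Y h hne
  have hri : ∀ j x, h.r.1 j (h.i.1 j x) = x := fun j x ↦ by rw [← comp_val, h.retract, id_val]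
  have hsurj : ∀ j, Function.Surjective (h.r.1 j) := fun j x ↦ ⟨_, hri j x⟩
  have hle : ∀ j, Module.finrank S (X.F j) ≤ Module.finrank S (Y.F j) := fun j ↦
    LinearMap.finrank_le_finrank_of_surjective (hsurj j)
  by_contra hlt
  refine hne ?_
  have heq : ∀ j, Module.finrank S (X.F j) = Module.finrank S (Y.F j) := by
    have := (Finset.sum_eq_sum_iff_of_le fun j (_ : j ∈ Finset.univ) ↦ hle j).1
      (le_antisymm (Finset.sum_le_sum fun j _ ↦ hle j) (not_lt.1 hlt))
    exact fun j ↦ this j (Finset.mem_univ j)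
  ext j y
  let E := LinearEquiv.ofFinrankEq _ _ (heq j)
  have hinj : Function.Injective (E.toLinearMap ∘ₗ h.r.1 j) :=
    OrzechProperty.injective_of_surjective_endomorphism _ (E.surjective.comp (hsurj j))
  apply hinj
  simp [hri]

/-- The direct sum. -/
def prod (A B : CycRep S σ N f) : CycRep S σ N f where
  F j := A.F j × B.F j
  φ j := (A.φ j).prodMap (B.φ j)
  pow_eq x j := by
    refine Prod.ext ?_ ?_
    · exact (map_totalMap_pow (F := fun j ↦ A.F j × B.F j)
        (fun j ↦ LinearMap.fst S (A.F j) (B.F j)) (fun j x ↦ rfl) N x j).trans (A.pow_eq _ j)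
    · exact (map_totalMap_pow (F := fun j ↦ A.F j × B.F j)
        (fun j ↦ LinearMap.snd S (A.F j) (B.F j)) (fun j x ↦ rfl) N x j).trans (B.pow_eq _ j)

/-- Direct sums of isomorphisms. -/
def prodIso {A A' B B' : CycRep S σ N f} (i : A ≅ A') (j : B ≅ B') : A.prod B ≅ A'.prod B' :=
  isoMk (fun k ↦ (isoComponent i k).prodCongr (isoComponent j k)) fun k x ↦
    Prod.ext (i.hom.2 k x.1) (j.hom.2 k x.2)

/-- The projection onto the first factor, as an endomorphism of the direct sum. -/
def prodIdem (A B : CycRep S σ N f) : A.prod B ⟶ A.prod B :=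
  ⟨fun j ↦ LinearMap.inl S _ _ ∘ₗ LinearMap.fst S (A.F j) (B.F j), fun j _ ↦
    Prod.ext rfl (map_zero (B.φ j)).symm⟩

/-- Indecomposability in terms of direct sums. -/
theorem isIndec_iff [IsLocalRing S] (X : CycRep S σ N f) :
    KrullSchmidt.IsIndec X ↔
      ¬ IsZero X ∧ ∀ A B : CycRep S σ N f, ¬ IsZero A → ¬ IsZero B → IsEmpty (X ≅ A.prod B) := by
  refine and_congr_right fun h0 ↦ ⟨fun h A B hA hB ↦ ⟨fun i ↦ ?_⟩, fun h e he ↦ ?_⟩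
  · rcases h (i.hom ≫ prodIdem A B ≫ i.inv) (by
      simp only [Category.assoc, Iso.inv_hom_id_assoc]
      rfl) with h' | h'
    · refine hA ?_
      rw [isZero_iff]
      intro j
      have h2 : prodIdem A B = 0 := by
        have := congrArg (fun t ↦ i.inv ≫ t ≫ i.hom) h'
        simpa using this
      refine subsingleton_of_forall_eq 0 fun a ↦ ?_
      exact congrArg (fun g : A.prod B ⟶ A.prod B ↦ (g.1 j (a, 0)).1) h2
    · refine hB ?_
      rw [isZero_iff]
      intro j
      have h2 : prodIdem A B = 𝟙 _ := by
        have := congrArg (fun t ↦ i.inv ≫ t ≫ i.hom) h'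
        simpa using this
      refine subsingleton_of_forall_eq 0 fun b ↦ ?_
      exact (congrArg (fun g : A.prod B ⟶ A.prod B ↦ (g.1 j (0, b)).2) h2).symm
  · by_contra! hne
    obtain ⟨A, iA, pA, hA, hA'⟩ := IsIdempotentComplete.idempotents_split X e he
    obtain ⟨B, iB, pB, hB, hB'⟩ := IsIdempotentComplete.idempotents_split X (𝟙 X - e)
      (Idempotents.idem_of_id_sub_idem e he)
    -- The composite passes through `e ≫ (𝟙 X - e) = 0`; the next one uses the opposite order.
    have hAB : iA ≫ pB = 0 := by
      have : iA ≫ pB = (iA ≫ pA ≫ iA) ≫ (pB ≫ iB) ≫ pB := by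
        simp only [Category.assoc, hB, reassoc_of% hA, Category.comp_id]
      rw [this, Category.assoc, Category.assoc, hB', ← Category.assoc pA, hA',
        ← Category.assoc e, Preadditive.comp_sub, he]
      simp
    have hBA : iB ≫ pA = 0 := by
      have : iB ≫ pA = (iB ≫ pB ≫ iB) ≫ (pA ≫ iA) ≫ pA := by
        simp only [Category.assoc, hA, reassoc_of% hB, Category.comp_id]
      rw [this, Category.assoc, Category.assoc, hA', ← Category.assoc pB, hB',
        ← Category.assoc _ e, Preadditive.sub_comp, he]
      simp
    have hid : pA ≫ iA + pB ≫ iB = 𝟙 X := by rw [hA', hB']; abel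
    refine (h A B (fun hz ↦ hne.1 ?_) (fun hz ↦ hne.2 ?_)).false ?_
    · rw [← hA', hz.eq_of_tgt pA 0, zero_comp]
    · have : 𝟙 X - e = 0 := by rw [← hB', hz.eq_of_tgt pB 0, zero_comp]
      exact (sub_eq_zero.1 this).symm
    · refine ⟨⟨fun j ↦ (pA.1 j).prod (pB.1 j), fun j x ↦ Prod.ext (pA.2 j x) (pB.2 j x)⟩,
        ⟨fun j ↦ (iA.1 j).coprod (iB.1 j), fun j x ↦ ?_⟩, ?_, ?_⟩
      · refine (congrArg₂ (· + ·) (iA.2 j x.1) (iB.2 j x.2)).trans ?_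
        exact (map_add (X.φ j) _ _).symm
      · ext j x
        exact congrArg (fun g : X ⟶ X ↦ g.1 j x) hid
      · ext j x
        obtain ⟨a, b⟩ := x
        refine Prod.ext ?_ ?_
        · refine (map_add (pA.1 j) (iA.1 j a) (iB.1 j b)).trans ?_
          rw [← comp_val, ← comp_val, hA, hBA]
          exact add_zero a
        · refine (map_add (pB.1 j) (iA.1 j a) (iB.1 j b)).trans ?_
          rw [← comp_val, ← comp_val, hB, hAB]
          exact zero_add b

end CycRep

end CycRep

end

/-! ## Comparison of cyclic representations with a single module with an endomorphism -/

section

open IsLocalRing CategoryTheory Limits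

namespace CycRep

variable {S : Type u} [CommRing S] {J : Type} {σ : J → J} {N : ℕ} {f : S}

theorem totalMap_const_pow {M : Type u} [AddCommGroup M] [Module S M] (g : Module.End S M)
    (σ : J → J) (k : ℕ) (x : J → M) (j : J) :
    (totalMap σ (fun _ ↦ M) (fun _ ↦ g) ^ k) x j = (g ^ k) (x (σ^[k] j)) := by
  induction k generalizing x with
  | zero => rfl
  | succ k ih =>
    rw [pow_succ, Module.End.mul_apply, ih, totalMap_apply, pow_succ, Module.End.mul_apply,
      Function.iterate_succ_apply']

theorem unit_pow_eq (X : CycRep S (id : Unit → Unit) N f) (x : X.F ()) :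
    ((show Module.End S (X.F ()) from X.φ ()) ^ N) x = f • x := by
  rw [← X.pow_eq (fun _ ↦ x) ()]
  exact (totalMap_const_pow (M := X.F ()) (X.φ ()) id N (fun _ ↦ x) ()).symm

/-- The constant diagram on a module with an endomorphism. -/
def constFunctor (hσ : ∀ j, σ^[N] j = j) :
    CycRep S (id : Unit → Unit) N f ⥤ CycRep S σ N f where
  obj X :=
    { F := fun _ ↦ X.F ()
      φ := fun _ ↦ X.φ ()
      pow_eq := fun x j ↦ by
        refine (totalMap_const_pow (M := X.F ()) (X.φ ()) σ N x j).trans ?_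
        rw [hσ]
        exact X.unit_pow_eq _ }
  map g := ⟨fun _ ↦ g.1 (), fun _ x ↦ g.2 () x⟩

instance (hσ : ∀ j, σ^[N] j = j) : (constFunctor (S := S) (f := f) hσ).Additive where

/-- The product of the modules of a diagram, with its total endomorphism. -/
def totalFunctor [Finite J] : CycRep S σ N f ⥤ CycRep S (id : Unit → Unit) N f where
  obj X :=
    { F := fun _ ↦ ∀ j, X.F j
      φ := fun _ ↦ totalMap σ X.F X.φ
      pow_eq := fun x j ↦ by
        refine (totalMap_const_pow (M := ∀ j, X.F j) (totalMap σ X.F X.φ) id N x j).trans ?_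
        rw [Function.iterate_id]
        exact funext fun i ↦ X.pow_eq _ i }
  map g := ⟨fun _ ↦ LinearMap.pi fun j ↦ g.1 j ∘ₗ LinearMap.proj j, fun _ x ↦
    funext fun j ↦ g.2 j (x (σ j))⟩

instance [Finite J] : (totalFunctor (S := S) (σ := σ) (N := N) (f := f)).Additive where

/-- Every diagram is a retract of the constant diagram on its total module. -/
theorem exists_retract_const [Finite J] (hσ : ∀ j, σ^[N] j = j) (hinj : Function.Injective σ)
    (X : CycRep S σ N f) : Nonempty (Retract X ((constFunctor hσ).obj (totalFunctor.obj X))) := by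
  classical
  refine ⟨⟨⟨fun j ↦ LinearMap.single S X.F j, fun j x ↦ funext fun k ↦ ?_⟩,
    ⟨fun j ↦ LinearMap.proj j, fun j y ↦ rfl⟩, ?_⟩⟩
  · change Pi.single j (X.φ j x) k = X.φ k ((Pi.single (σ j) x : ∀ j, X.F j) (σ k))
    by_cases h : k = j
    · subst h
      simp
    -- Injectivity of `σ` ensures that a vector supported at `σ j` is only seen by the map ending at
    -- `j`.
    · rw [Pi.single_eq_of_ne h, Pi.single_eq_of_ne (fun h' ↦ h (hinj h')), map_zero]
  · ext j x
    exact Pi.single_eq_same j x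

/-- A multiple of the sum of the coordinates. -/
def scaledSum (J : Type) [Fintype J] (M : Type u) [AddCommGroup M] [Module S M] (c : S) :
    (J → M) →ₗ[S] M :=
  c • ∑ j : J, LinearMap.proj j

theorem scaledSum_apply [Fintype J] (M : Type u) [AddCommGroup M] [Module S M] (c : S)
    (y : J → M) : scaledSum J M c y = c • ∑ j, y j := by
  simp [scaledSum]

theorem scaledSum_map [Fintype J] {M : Type u} [AddCommGroup M] [Module S M] (c : S)
    (hbij : Function.Bijective σ) (g : M →ₗ[S] M) (y : J → M) :
    scaledSum J M c (fun j ↦ g (y (σ j))) = g (scaledSum J M c y) := by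
  rw [scaledSum_apply, scaledSum_apply, map_smul, ← map_sum, hbij.sum_comp y]

theorem scaledSum_const [Fintype J] {M : Type u} [AddCommGroup M] [Module S M] {c : S}
    (hc : c * (Fintype.card J : S) = 1) (x : M) : scaledSum J M c (fun _ ↦ x) = x := by
  rw [scaledSum_apply, Finset.sum_const, Finset.card_univ, ← Nat.cast_smul_eq_nsmul S, smul_smul,
    hc, one_smul]

/-- If the number of vertices is invertible, then every module with an endomorphism is a retract of
the total module of its constant diagram. -/
theorem exists_retract_total [Fintype J] (hσ : ∀ j, σ^[N] j = j) (hbij : Function.Bijective σ)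
    (hJ : IsUnit (Fintype.card J : S)) (X : CycRep S (id : Unit → Unit) N f) :
    Nonempty (Retract X (totalFunctor.obj ((constFunctor (σ := σ) hσ).obj X))) := by
  -- With `c` the inverse of the number of vertices, `scaledSum` is the average. It retracts the
  -- diagonal and commutes with the total map because `σ` permutes the coordinates.
  obtain ⟨c, hc⟩ := hJ.exists_left_inv
  exact ⟨⟨⟨fun _ ↦ LinearMap.pi fun _ ↦ LinearMap.id, fun _ x ↦ rfl⟩,
    ⟨fun _ ↦ scaledSum J (X.F ()) c, fun _ y ↦ scaledSum_map (M := X.F ()) c hbij (X.φ ()) y⟩,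
    hom_ext fun _ x ↦ scaledSum_const hc x⟩⟩

/-- Apply descent of finite type to each functor in turn. Invertibility of the number of vertices
enters only in passing from the cycle to the single vertex. -/
theorem finiteType_iff [IsLocalRing S] [IsNoetherianRing S] [IsAdicComplete (maximalIdeal S) S]
    [Fintype J] (hσ : ∀ j, σ^[N] j = j) (hbij : Function.Bijective σ)
    (hJ : IsUnit (Fintype.card J : S)) :
    KrullSchmidt.FiniteType (CycRep S σ N f) ↔
      KrullSchmidt.FiniteType (CycRep S (id : Unit → Unit) N f) :=
  ⟨KrullSchmidt.FiniteType.of_retract localEnds rankMono rankMono totalFunctor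
      fun X ↦ ⟨_, exists_retract_total hσ hbij hJ X⟩,
    KrullSchmidt.FiniteType.of_retract localEnds rankMono rankMono (constFunctor hσ)
      fun X ↦ ⟨_, exists_retract_const hσ hbij.injective X⟩⟩

end CycRep

end

/-! ### Matrix factorizations as cyclic diagrams -/

section

open IsLocalRing CategoryTheory Limits

namespace KrullSchmidt

universe v₁ u₁

theorem finiteType_iff_exists_fin {C : Type u₁} [Category.{v₁} C] [Preadditive C] :
    FiniteType C ↔ ∃ (n : ℕ) (X : Fin n → C), (∀ i, IsIndec (X i)) ∧
      ∀ Y, IsIndec Y → ∃ i, Nonempty (Y ≅ X i) := by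
  constructor
  · rintro ⟨s, hs, h⟩
    have hfin : Finite {X : C // X ∈ s ∧ IsIndec X} :=
      (hs.subset fun X (hX : X ∈ s ∧ IsIndec X) ↦ hX.1).to_subtype
    obtain ⟨n, ⟨e⟩⟩ := Finite.exists_equiv_fin {X : C // X ∈ s ∧ IsIndec X}
    refine ⟨n, fun i ↦ (e.symm i).1, fun i ↦ (e.symm i).2.2, fun Y hY ↦ ?_⟩
    obtain ⟨X, hX, ⟨i⟩⟩ := h Y hY
    exact ⟨e ⟨X, hX, hY.of_iso i⟩, by simpa using ⟨i⟩⟩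
  · rintro ⟨n, X, -, h⟩
    exact ⟨Set.range X, Set.finite_range X, fun Y hY ↦
      let ⟨i, hi⟩ := h Y hY
      ⟨X i, ⟨i, rfl⟩, hi⟩⟩

end KrullSchmidt

namespace CycRep

variable {S : Type u} [CommRing S] {J : Type} {σ : J → J} {N : ℕ} {f : S}

/-- On a vector supported at `σ j`, the first map applied by the `N`-fold composite is `φ j`. A
kernel vector is thus killed by `f`, hence zero. -/
theorem injective_φ [IsDomain S] (hf : f ≠ 0) (hN : N ≠ 0) (hinj : Function.Injective σ)
    (X : CycRep S σ N f) (j : J) : Function.Injective (X.φ j) := by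
  classical
  rw [injective_iff_map_eq_zero]
  intro x hx
  obtain ⟨n, rfl⟩ := Nat.exists_eq_succ_of_ne_zero hN
  have h := X.pow_eq (Pi.single (σ j) x) (σ j)
  have h0 : totalMap σ X.F X.φ (Pi.single (σ j) x) = 0 := by
    funext k
    rw [totalMap_apply]
    by_cases hk : k = j
    · subst hk
      simpa using hx
    · rw [Pi.single_eq_of_ne (fun h' ↦ hk (hinj h')), map_zero]
      rfl
  rw [pow_succ, Module.End.mul_apply, h0, map_zero, Pi.single_eq_same, Pi.zero_apply] at h
  exact (smul_eq_zero.1 h.symm).resolve_left hf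

end CycRep

namespace MatFac

variable {S : Type u} [CommRing S] {d : ℕ} {f : S}

theorem forall_zmod {d : ℕ} [NeZero d] {P : ZMod d → Prop} (h1 : P 1)
    (h : ∀ i, P i → P (i + 1)) (i : ZMod d) : P i := by
  have : ∀ n : ℕ, P (1 + n) := by
    intro n
    induction n with
    | zero => simpa using h1
    | succ n ih => simpa [add_assoc] using h _ ih
  have h2 := this (i - 1).val
  rwa [ZMod.natCast_zmod_val, add_sub_cancel] at h2

/-- The definition imposes the factorization only at index `1`; this rotates it around the cycle. If
it holds at `i`, the image of `φ i` contains `f • F i` and so has full rank, and equality of ranks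
makes `φ i` injective. Then `φ i` can be cancelled to obtain the identity at `i + 1`. -/
theorem cyclicMap_pow_apply [IsDomain S] [IsNoetherianRing S] [NeZero d] (hf : f ≠ 0)
    (X : MatFac S d f)
    (x : ∀ i, X.F i) (i : ZMod d) : (cyclicMap X.F X.φ ^ d) x i = f • x i := by
  revert x
  refine forall_zmod (P := fun i ↦ ∀ x : ∀ i, X.F i, (cyclicMap X.F X.φ ^ d) x i = f • x i)
    X.factorization (fun i hi x ↦ ?_) i
  classical
  have hrange : ∀ y : X.F i, f • y ∈ LinearMap.range (X.φ i) := by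
    intro y
    have h := hi (Pi.single i y)
    rw [Pi.single_eq_same] at h
    rw [← h]
    obtain ⟨n, hn⟩ := Nat.exists_eq_succ_of_ne_zero (NeZero.ne d)
    rw [show (cyclicMap X.F X.φ ^ d) = cyclicMap X.F X.φ ^ (n + 1) from congrArg _ hn, pow_succ',
      Module.End.mul_apply]
    exact ⟨_, rfl⟩
  have hrank : Module.finrank S (LinearMap.range (X.φ i)) = Module.finrank S (X.F i) := by
    refine le_antisymm (Submodule.finrank_le _) ?_
    refine LinearMap.finrank_le_finrank_of_injective
      (f := (LinearMap.lsmul S (X.F i) f).codRestrict (LinearMap.range (X.φ i)) hrange) ?_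
    intro a b hab
    exact smul_right_injective _ hf (congrArg Subtype.val hab)
  have hinj : Function.Injective (X.φ i) := by
    have h := Submodule.finrank_quotient_add_finrank (LinearMap.ker (X.φ i))
    rw [(X.φ i).quotKerEquivRange.finrank_eq, hrank, X.finrank_eq i (i + 1), Nat.add_eq_left] at h
    rw [← LinearMap.ker_eq_bot]
    exact (Submodule.finrank_eq_zero).1 h
  apply hinj
  change (cyclicMap X.F X.φ) ((cyclicMap X.F X.φ ^ d) x) i = _
  rw [← Module.End.mul_apply, ← pow_succ', pow_succ, Module.End.mul_apply, hi, map_smul]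
  rfl

/-- A matrix factorization as a cyclic diagram. -/
def toRep [IsDomain S] [IsNoetherianRing S] [NeZero d] (hf : f ≠ 0) (X : MatFac S d f) :
    CycRep S (fun i : ZMod d ↦ i + 1) d f where
  F := X.F
  φ := X.φ
  pow_eq := cyclicMap_pow_apply hf X

/-- A function that is nonincreasing around a cycle is constant. Applied to ranks, it recovers the
equal-rank condition for cyclic diagrams. -/
theorem le_of_forall_succ_le [NeZero d] (r : ZMod d → ℕ) (h : ∀ i, r (i + 1) ≤ r i)
    (i j : ZMod d) : r i ≤ r j := by
  have : ∀ n : ℕ, r (j + n) ≤ r j := by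
    intro n
    induction n with
    | zero => simp
    | succ n ih =>
      refine le_trans ?_ ih
      rw [Nat.cast_succ, ← add_assoc]
      exact h _
  have h2 := this (i - j).val
  rwa [ZMod.natCast_zmod_val, add_sub_cancel] at h2

theorem finrank_succ_le [IsDomain S] [NeZero d] (hf : f ≠ 0)
    (X : CycRep S (fun i : ZMod d ↦ i + 1) d f) (i : ZMod d) :
    Module.finrank S (X.F (i + 1)) ≤ Module.finrank S (X.F i) :=
  LinearMap.finrank_le_finrank_of_injective
    (X.injective_φ hf (NeZero.ne d) (add_left_injective 1) i)

/-- A cyclic diagram as a matrix factorization. -/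
def ofRep [IsDomain S] [NeZero d] (hf : f ≠ 0) (X : CycRep S (fun i : ZMod d ↦ i + 1) d f) :
    MatFac S d f where
  F := X.F
  φ := X.φ
  finrank_eq := by
    exact fun i j ↦ le_antisymm
      (le_of_forall_succ_le (fun i ↦ Module.finrank S (X.F i)) (finrank_succ_le hf X) i j)
      (le_of_forall_succ_le (fun i ↦ Module.finrank S (X.F i)) (finrank_succ_le hf X) j i)
  factorization x := X.pow_eq x 1

variable [IsDomain S] [IsNoetherianRing S] [NeZero d]

theorem nonempty_iso_iff (hf : f ≠ 0) (X Y : MatFac S d f) :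
    Nonempty (X.Iso Y) ↔ Nonempty (X.toRep hf ≅ Y.toRep hf) :=
  ⟨fun ⟨i⟩ ↦ ⟨CycRep.isoMk i.α i.comm⟩,
    fun ⟨i⟩ ↦ ⟨⟨fun j ↦ CycRep.isoComponent i j, fun j x ↦ i.hom.2 j x⟩⟩⟩

theorem isNonzero_iff (hf : f ≠ 0) (X : MatFac S d f) : X.IsNonzero ↔ ¬ IsZero (X.toRep hf) :=
  (CycRep.not_isZero_iff (X.toRep hf)).symm

theorem isIndecomposable_iff [IsLocalRing S] (hf : f ≠ 0) (X : MatFac S d f) :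
    X.IsIndecomposable ↔ KrullSchmidt.IsIndec (X.toRep hf) := by
  rw [CycRep.isIndec_iff, IsIndecomposable, isNonzero_iff hf]
  refine and_congr_right fun _ ↦ ⟨fun h A B hA hB ↦ ⟨fun i ↦ ?_⟩, fun h Y Z hY hZ ↦ ⟨fun i ↦ ?_⟩⟩
  · exact (h (ofRep hf A) (ofRep hf B) ((isNonzero_iff hf _).2 hA)
      ((isNonzero_iff hf _).2 hB)).false ((nonempty_iso_iff hf X
        ((ofRep hf A).directSum (ofRep hf B))).2 ⟨i⟩).some
  · exact (h (Y.toRep hf) (Z.toRep hf) ((isNonzero_iff hf _).1 hY)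
      ((isNonzero_iff hf _).1 hZ)).false ((nonempty_iso_iff hf X (Y.directSum Z)).1 ⟨i⟩).some

theorem hasFiniteMFType_iff [IsLocalRing S] (hf : f ≠ 0) :
    HasFiniteMFType d f ↔
      KrullSchmidt.FiniteType (CycRep S (fun i : ZMod d ↦ i + 1) d f) := by
  rw [KrullSchmidt.finiteType_iff_exists_fin]
  constructor
  · rintro ⟨n, X, hX, h⟩
    refine ⟨n, fun i ↦ (X i).toRep hf, fun i ↦ (isIndecomposable_iff hf _).1 (hX i),
      fun Y hY ↦ ?_⟩
    obtain ⟨i, hi⟩ := h (ofRep hf Y) ((isIndecomposable_iff hf _).2 hY)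
    exact ⟨i, (nonempty_iso_iff hf _ _).1 hi⟩
  · rintro ⟨n, X, hX, h⟩
    refine ⟨n, fun i ↦ ofRep hf (X i), fun i ↦ (isIndecomposable_iff hf _).2 (hX i),
      fun Y hY ↦ ?_⟩
    obtain ⟨i, hi⟩ := h (Y.toRep hf) ((isIndecomposable_iff hf _).1 hY)
    exact ⟨i, (nonempty_iso_iff hf Y (ofRep hf (X i))).2 hi⟩

end MatFac

end

/-! ## Regular local rings -/

section

open IsLocalRing RingTheory.Sequence

section RegularLocalRing

/-- Since `x` is nonzero in the cotangent space, lifts of a basis of the quotient by its line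
complete it to a generating set, by Nakayama. -/
theorem exists_finset_span_insert_eq_maximalIdeal {R : Type u} [CommRing R] [IsLocalRing R]
    [IsNoetherianRing R] {x : R} (hx : x ∈ maximalIdeal R) (hx2 : x ∉ maximalIdeal R ^ 2) {n : ℕ}
    (hn : (maximalIdeal R).spanFinrank = n + 1) :
    ∃ y : Fin n → R, Ideal.span (insert x (Set.range y)) = maximalIdeal R := by
  rw [spanFinrank_maximalIdeal_eq_finrank_cotangentSpace] at hn
  set x' : CotangentSpace R := (maximalIdeal R).toCotangent ⟨x, hx⟩ with hx'
  have hx0 : x' ≠ 0 := by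
    rwa [hx', Ne, Ideal.toCotangent_eq_zero]
  have hq : Module.finrank (ResidueField R)
      (CotangentSpace R ⧸ Submodule.span (ResidueField R) {x'}) = n := by
    have := Submodule.finrank_quotient_add_finrank (Submodule.span (ResidueField R) {x'})
    rw [finrank_span_singleton hx0, hn] at this
    omega
  let b := Module.finBasisOfFinrankEq _ _ hq
  choose v hv using fun i ↦ (Submodule.mkQ_surjective _ (b i))
  choose y hy using fun i ↦ (maximalIdeal R).toCotangent_surjective (v i)
  refine ⟨fun i ↦ (y i : R), ?_⟩
  have hspan : Submodule.span (ResidueField R) ((maximalIdeal R).toCotangent ''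
      (insert ⟨x, hx⟩ (Set.range y)) : Set (CotangentSpace R)) = ⊤ := by
    rw [Set.image_insert_eq, ← Set.range_comp, Submodule.span_insert]
    have h1 : (⇑(maximalIdeal R).toCotangent ∘ y) = v := funext hy
    rw [h1, eq_top_iff]
    intro w _
    have h2 : (Submodule.span (ResidueField R) {x'}).mkQ w ∈
        (Submodule.span (ResidueField R) (Set.range v)).map
          (Submodule.span (ResidueField R) {x'}).mkQ := by
      rw [Submodule.map_span, ← Set.range_comp,
        show (⇑(Submodule.span (ResidueField R) {x'}).mkQ ∘ v) = b from funext hv, b.span_eq]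
      trivial
    obtain ⟨u, hu, huw⟩ := h2
    have h3 : w - u ∈ Submodule.span (ResidueField R) {x'} := by
      rw [← Submodule.Quotient.mk_eq_zero, Submodule.Quotient.mk_sub, sub_eq_zero]
      exact huw.symm
    rw [← sub_add_cancel w u]
    exact Submodule.add_mem_sup h3 hu
  rw [CotangentSpace.span_image_eq_top_iff] at hspan
  have := congrArg (Submodule.map (maximalIdeal R).subtype) hspan
  rw [Submodule.map_span, Set.image_insert_eq, ← Set.range_comp, Submodule.map_top,
    Submodule.range_subtype] at this
  exact this

theorem map_mk_maximalIdeal {R : Type u} [CommRing R] [IsLocalRing R] (I : Ideal R)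
    [IsLocalRing (R ⧸ I)] :
    (maximalIdeal R).map (Ideal.Quotient.mk I) = maximalIdeal (R ⧸ I) := by
  have hloc : IsLocalHom (Ideal.Quotient.mk I) :=
    IsLocalHom.of_surjective _ Ideal.Quotient.mk_surjective
  refine le_antisymm (Ideal.map_le_iff_le_comap.2 fun a ha h ↦ ha (hloc.map_nonunit a h)) ?_
  intro y hy
  obtain ⟨a, rfl⟩ := Ideal.Quotient.mk_surjective y
  exact Ideal.mem_map_of_mem _ fun h ↦ hy (h.map _)

/-- Killing a minimal generator leaves at most `n` generators of the maximal ideal, while the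
dimension drops by at most one; the two bounds force regularity. -/
theorem isRegularLocalRing_quotient {R : Type u} [CommRing R] [IsRegularLocalRing R] {x : R}
    (hx : x ∈ maximalIdeal R) (hx2 : x ∉ maximalIdeal R ^ 2) {n : ℕ}
    (hn : (maximalIdeal R).spanFinrank = n + 1) :
    ∃ _ : IsRegularLocalRing (R ⧸ Ideal.span {x}),
      (maximalIdeal (R ⧸ Ideal.span {x})).spanFinrank = n := by
  have hle : Ideal.span {x} ≤ maximalIdeal R := (Ideal.span_singleton_le_iff_mem _).2 hx
  have hne : Ideal.span {x} ≠ ⊤ :=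
    fun h ↦ (maximalIdeal.isMaximal R).ne_top (top_le_iff.1 (h ▸ hle))
  have : Nontrivial (R ⧸ Ideal.span {x}) := Ideal.Quotient.nontrivial_iff.2 hne
  have : IsLocalRing (R ⧸ Ideal.span {x}) :=
    IsLocalRing.of_surjective' (Ideal.Quotient.mk _) Ideal.Quotient.mk_surjective
  obtain ⟨y, hy⟩ := exists_finset_span_insert_eq_maximalIdeal hx hx2 hn
  have hgen : maximalIdeal (R ⧸ Ideal.span {x}) =
      Ideal.span (Set.range fun i ↦ Ideal.Quotient.mk (Ideal.span {x}) (y i)) := by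
    rw [← map_mk_maximalIdeal, ← hy, Ideal.map_span, Set.image_insert_eq, ← Set.range_comp,
      Ideal.Quotient.eq_zero_iff_mem.2 (Ideal.mem_span_singleton_self x), Ideal.span_insert_zero]
    rfl
  have hspan : (maximalIdeal (R ⧸ Ideal.span {x})).spanFinrank ≤ n := by
    rw [hgen]
    refine (Submodule.spanFinrank_span_le_ncard_of_finite (Set.finite_range _)).trans ?_
    rw [← Set.image_univ]
    refine (Set.ncard_image_le Set.finite_univ).trans ?_
    simp
  have hdim : (n : WithBot ℕ∞) ≤ ringKrullDim (R ⧸ Ideal.span {x}) := by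
    have h1 := ringKrullDim_le_ringKrullDim_quotient_add_spanFinrank (Ideal.span {x})
      (by rwa [ringJacobson_eq_maximalIdeal])
    have h2 : (Ideal.span {x}).spanFinrank ≤ 1 := by
      rw [← Set.ncard_singleton x]
      exact Submodule.spanFinrank_span_le_ncard_of_finite (Set.finite_singleton x)
    rw [← IsRegularLocalRing.spanFinrank_maximalIdeal, hn] at h1
    have h3 : ((n : ℕ) : WithBot ℕ∞) + (1 : ℕ) ≤ ringKrullDim (R ⧸ Ideal.span {x}) + (1 : ℕ) := by
      refine le_trans (by exact_mod_cast h1) (add_le_add_right (α := WithBot ℕ∞) ?_ _)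
      exact_mod_cast h2
    exact ENat.WithBot.add_le_add_natCast_right_iff.1 h3
  have hreg : IsRegularLocalRing (R ⧸ Ideal.span {x}) :=
    IsRegularLocalRing.of_spanFinrank_maximalIdeal_le _ (le_trans (by exact_mod_cast hspan) hdim)
  refine ⟨hreg, le_antisymm hspan ?_⟩
  rw [← hreg.spanFinrank_maximalIdeal] at hdim
  exact_mod_cast hdim

/-- By prime avoidance, which tolerates the non-prime `maximalIdeal R ^ 2`. Containment of the
maximal ideal in its square contradicts Nakayama; containment in a minimal prime contradicts
positive dimension. -/
theorem exists_notMem_sq_notMem_minimalPrimes {R : Type u} [CommRing R] [IsRegularLocalRing R]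
    {n : ℕ} (hn : (maximalIdeal R).spanFinrank = n + 1) :
    ∃ x ∈ maximalIdeal R, x ∉ maximalIdeal R ^ 2 ∧ ∀ p ∈ minimalPrimes R, x ∉ p := by
  classical
  have hfin := minimalPrimes.finite_of_isNoetherianRing R
  by_contra! hcon
  have hdim := IsRegularLocalRing.spanFinrank_maximalIdeal (R := R)
  have hsub : ((maximalIdeal R : Ideal R) : Set R) ⊆ ⋃ I ∈
      ((insert (maximalIdeal R ^ 2) hfin.toFinset : Finset (Ideal R)) : Set (Ideal R)),
      (I : Set R) := by
    intro x hx
    by_cases hx2 : x ∈ maximalIdeal R ^ 2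
    · exact Set.mem_biUnion (by simp) hx2
    · obtain ⟨p, hp, hxp⟩ := hcon x hx hx2
      exact Set.mem_biUnion (x := p) (by simp [hp]) hxp
  rw [Ideal.subset_union_prime (f := fun I ↦ I) (maximalIdeal R ^ 2) (maximalIdeal R ^ 2) (by
    intro I hI hne _
    have : I ∈ minimalPrimes R := by simpa [hne] using hI
    exact this.1.1)] at hsub
  obtain ⟨I, hI, hle⟩ := hsub
  rcases Finset.mem_insert.1 hI with rfl | hI
  · have h0 : maximalIdeal R = ⊥ := by
      refine Submodule.eq_bot_of_le_smul_of_le_jacobson_bot (maximalIdeal R) _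
        (IsNoetherian.noetherian _) ?_ (maximalIdeal_le_jacobson _)
      rwa [smul_eq_mul, ← pow_two]
    rw [h0] at hn
    simp at hn
  · have hmin : maximalIdeal R ∈ minimalPrimes R := by
      have hI' : I ∈ minimalPrimes R := by simpa using hI
      have : I = maximalIdeal R := le_antisymm (le_maximalIdeal hI'.1.1.ne_top) hle
      rwa [← this]
    have hh : (maximalIdeal R).height = 0 := Ideal.height_eq_zero_iff.2 hmin
    rw [← maximalIdeal_height_eq_ringKrullDim, hh, hn] at hdim
    norm_cast at hdim

/-- Regular local rings are domains, and their maximal ideals are generated by regular sequences. -/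
theorem isDomain_and_exists_isWeaklyRegular (R : Type u) [CommRing R] [IsRegularLocalRing R] :
    IsDomain R ∧ ∃ rs : List R, IsWeaklyRegular R rs ∧ Ideal.ofList rs = maximalIdeal R := by
  induction hn : (maximalIdeal R).spanFinrank generalizing R with
  | zero =>
    have h0 : maximalIdeal R = ⊥ := by
      rw [Submodule.spanFinrank_eq_zero_iff_eq_bot] at hn
      · exact hn
      · exact IsNoetherian.noetherian _
    have hf : IsField R := isField_iff_maximalIdeal_eq.2 h0
    exact ⟨hf.isDomain, [], IsWeaklyRegular.nil R R, by simp [h0]⟩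
  | succ n ih =>
    obtain ⟨x, hx, hx2, hxmin⟩ := exists_notMem_sq_notMem_minimalPrimes hn
    obtain ⟨hreg, hn'⟩ := isRegularLocalRing_quotient hx hx2 hn
    obtain ⟨hdom, rs, hrs, hrs'⟩ := ih _ hn'
    have hprime : (Ideal.span {x}).IsPrime := (Ideal.Quotient.isDomain_iff_prime _).1 hdom
    obtain ⟨p, hp, hpx⟩ := Ideal.exists_minimalPrimes_le (I := (⊥ : Ideal R)) (J := Ideal.span {x})
      bot_le
    have hpprime : p.IsPrime := hp.1.1
    -- The minimal prime `p` lies in the ideal generated by `x` but does not contain `x`, so `p = x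
    -- p`, and Nakayama gives `p = 0`.
    have hp0 : p = ⊥ := by
      refine Submodule.eq_bot_of_le_smul_of_le_jacobson_bot (Ideal.span {x}) _
        (IsNoetherian.noetherian _) ?_
        (((Ideal.span_singleton_le_iff_mem _).2 hx).trans (maximalIdeal_le_jacobson _))
      intro y hy
      obtain ⟨z, rfl⟩ := Ideal.mem_span_singleton'.1 (hpx hy)
      rw [mul_comm]
      exact Submodule.smul_mem_smul (Ideal.mem_span_singleton_self x)
        ((hpprime.mem_or_mem hy).resolve_right (hxmin p hp))
    have hR : IsDomain R := by
      rw [hp0] at hpprime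
      exact IsDomain.of_bot_isPrime R
    refine ⟨hR, ?_⟩
    obtain ⟨rs', rfl⟩ : ∃ l : List R, l.map (Ideal.Quotient.mk (Ideal.span {x})) = rs :=
      (List.map_surjective_iff.2 Ideal.Quotient.mk_surjective) rs
    refine ⟨x :: rs', ?_, ?_⟩
    · rw [isWeaklyRegular_cons_iff]
      refine ⟨?_, ?_⟩
      · intro a b hab
        refine mul_left_cancel₀ ?_ hab
        rintro rfl
        exact hx2 (zero_mem _)
      · have hrs2 := (isWeaklyRegular_map_algebraMap_iff (R ⧸ Ideal.span {x})
          (R ⧸ Ideal.span {x}) rs').1 hrs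
        refine (LinearEquiv.isWeaklyRegular_congr (Submodule.quotEquivOfEq _ _ ?_) rs').2 hrs2
        rw [← Submodule.ideal_span_singleton_smul, smul_eq_mul, Ideal.mul_top]
    · rw [← Ideal.map_ofList, ← map_mk_maximalIdeal,
        Ideal.map_eq_iff_sup_ker_eq_of_surjective _ Ideal.Quotient.mk_surjective, Ideal.mk_ker,
        sup_eq_left.2 ((Ideal.span_singleton_le_iff_mem _).2 hx)] at hrs'
      rw [Ideal.ofList_cons, sup_comm, hrs']

end RegularLocalRing

end

/-! ## Projective dimension over a regular local ring -/

section

open IsLocalRing RingTheory.Sequence CategoryTheory Abelian Pointwise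

section ProjectiveDimension

variable {S A N : Type u} [CommRing S] [CommRing A] [Algebra S A] [AddCommGroup N] [Module S N]
  [Module A N] [IsScalarTower S A N]

/-- Multiplication by a ring element, as a linear endomorphism over the base ring. -/
def smulHom (S : Type u) {A N : Type u} [CommRing S] [CommRing A] [Algebra S A] [AddCommGroup N]
    [Module S N] [Module A N] [IsScalarTower S A N] (a : A) :
    ModuleCat.of S N ⟶ ModuleCat.of S N :=
  ModuleCat.ofHom (Algebra.lsmul S S N a)

/-- The action of a ring element on `Ext`. -/
noncomputable def extSMul (N : Type u) [AddCommGroup N] [Module S N] [Module A N]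
    [IsScalarTower S A N] (L : ModuleCat.{u} S) (n : ℕ) :
    A →ₗ[S] Module.End S (Ext (ModuleCat.of S N) L n) where
  toFun a :=
    { toFun := fun e ↦ (Ext.mk₀ (smulHom S a)).comp e (zero_add n)
      map_add' := fun x y ↦ by simp
      map_smul' := fun c x ↦ by simp [Ext.comp_smul] }
  map_add' a b := by
    ext e
    have : smulHom (N := N) S (a + b) = smulHom S a + smulHom S b := by
      ext x
      exact add_smul a b x
    simp [this, Ext.mk₀_add]
  map_smul' c a := by
    ext e
    have : smulHom (N := N) S (c • a) = c • smulHom S a := by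
      ext x
      exact smul_assoc c a x
    simp [this, Ext.mk₀_smul, Ext.smul_comp]

theorem extSMul_apply (L : ModuleCat.{u} S) (n : ℕ) (a : A) (e : Ext (ModuleCat.of S N) L n) :
    extSMul N L n a e = (Ext.mk₀ (smulHom S a)).comp e (zero_add n) := rfl

theorem extSMul_pow_surjective (L : ModuleCat.{u} S) (n : ℕ) (a : A)
    (h : Function.Surjective (extSMul N L n a)) (m : ℕ) :
    Function.Surjective (extSMul N L n (a ^ m)) := by
  induction m with
  | zero =>
    intro e
    refine ⟨e, ?_⟩
    have : smulHom (N := N) S (1 : A) = 𝟙 _ := by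
      ext x
      exact one_smul A x
    rw [pow_zero, extSMul_apply, this, Ext.mk₀_id_comp]
  | succ m ih =>
    intro e
    obtain ⟨e₁, rfl⟩ := h e
    obtain ⟨e₂, rfl⟩ := ih e₁
    refine ⟨e₂, ?_⟩
    have : smulHom (N := N) S (a ^ (m + 1)) = smulHom S a ≫ smulHom S (a ^ m) := by
      ext x
      exact (congrArg (· • x) (pow_succ a m)).trans (mul_smul (a ^ m) a x)
    rw [extSMul_apply, extSMul_apply, extSMul_apply, this, Ext.mk₀_comp_mk₀_assoc]

theorem exact_smul_mkQ (S : Type u) [CommRing S] [Algebra S A] [Module S N] [IsScalarTower S A N]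
    (y : A) :
    Function.Exact (Algebra.lsmul S S N y : N →ₗ[S] N)
      ((y • (⊤ : Submodule A N)).mkQ.restrictScalars S) := by
  intro x
  rw [LinearMap.restrictScalars_apply, Submodule.mkQ_apply, Submodule.Quotient.mk_eq_zero,
    Submodule.mem_smul_pointwise_iff_exists]
  exact ⟨fun ⟨z, _, hz⟩ ↦ ⟨z, hz⟩, fun ⟨z, hz⟩ ↦ ⟨z, trivial, hz⟩⟩

theorem shortExact_of_linearMap {M₁ M₂ M₃ : Type u} [AddCommGroup M₁] [AddCommGroup M₂]
    [AddCommGroup M₃] [Module S M₁] [Module S M₂] [Module S M₃] (f : M₁ →ₗ[S] M₂) (g : M₂ →ₗ[S] M₃)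
    (hfg : Function.Exact f g) (hf : Function.Injective f) (hg : Function.Surjective g) :
    (ModuleCat.shortComplexOfCompEqZero f g hfg.linearMap_comp_eq_zero).ShortExact :=
  ModuleCat.shortComplex_shortExact _ hfg hf hg

theorem injective_lsmul {y : A} (hy : IsSMulRegular N y) :
    Function.Injective (Algebra.lsmul S S N y : N →ₗ[S] N) := fun _ _ h ↦ hy h

/-- Dividing by a nonzerodivisor raises the projective dimension over a local ring `S`, also if it
is a topologically nilpotent element of an `S`-algebra. -/
theorem hasProjectiveDimensionLT_of_quotSMulTop [IsLocalRing S] [IsNoetherianRing S]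
    [Module.Finite S N] {y : A} (hy : IsSMulRegular N y) {m : ℕ}
    (hm : y ^ m ∈ (maximalIdeal S).map (algebraMap S A)) {k : ℕ}
    (h : HasProjectiveDimensionLT (ModuleCat.of S (QuotSMulTop y N)) (k + 2)) :
    HasProjectiveDimensionLT (ModuleCat.of S N) (k + 1) := by
  -- Testing against finite `L` suffices, and the `Ext` modules are then finitely generated, as
  -- Nakayama requires.
  apply ModuleCat.hasProjectiveDimensionLT_of_forall_finite
  intro L _
  let q : N →ₗ[S] QuotSMulTop y N := (y • (⊤ : Submodule A N)).mkQ.restrictScalars S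
  have hq : Function.Surjective q := Submodule.mkQ_surjective (y • (⊤ : Submodule A N))
  have hinj := injective_lsmul (S := S) hy
  -- In the long exact sequence, the cokernel of `y` on `Ext` in degree `k + 1` embeds in `Ext` of
  -- `N / yN` in degree `k + 2`, which vanishes.
  have hsurj : Function.Surjective (extSMul N L (k + 1) y) := by
    intro e
    have hz : Subsingleton (Ext (ModuleCat.of S (QuotSMulTop y N)) L (k + 2)) :=
      HasProjectiveDimensionLT.subsingleton _ (k + 2) _ le_rfl L
    have hex : Function.Exact (Algebra.lsmul S S N y : N →ₗ[S] N) q := exact_smul_mkQ S y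
    have hse := shortExact_of_linearMap (Algebra.lsmul S S N y : N →ₗ[S] N) q hex hinj hq
    obtain ⟨e', he'⟩ := Ext.contravariant_sequence_exact₁ hse L e
      (n₁ := k + 2) (by omega) (hz.elim _ _)
    exact ⟨e', he'⟩
  have hpow := extSMul_pow_surjective L (k + 1) y hsurj m
  -- A power of `y` acts surjectively and lies in the extension of the maximal ideal of `S`, so this
  -- `Ext` equals its multiple by that ideal.
  have hle : (⊤ : Submodule S (Ext (ModuleCat.of S N) L (k + 1))) ≤ maximalIdeal S • ⊤ := by
    intro e _
    obtain ⟨e', rfl⟩ := hpow e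
    have h1 : y ^ m ∈ maximalIdeal S • (⊤ : Submodule S A) := by
      rw [Ideal.smul_top_eq_map]
      exact hm
    have h2 : (extSMul N L (k + 1)).flip e' (y ^ m) ∈
        (maximalIdeal S • (⊤ : Submodule S A)).map ((extSMul N L (k + 1)).flip e') :=
      Submodule.mem_map_of_mem h1
    rw [Submodule.map_smul''] at h2
    exact Submodule.smul_mono le_rfl le_top h2
  have hbot := Submodule.eq_bot_of_le_smul_of_le_jacobson_bot (maximalIdeal S) _
    (Module.Finite.fg_top) hle (maximalIdeal_le_jacobson _)
  exact (Submodule.subsingleton_iff S).1 (subsingleton_of_bot_eq_top hbot.symm)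

end ProjectiveDimension

end

/-! ## Maximal Cohen–Macaulay modules over finite free extensions -/

section

open IsLocalRing RingTheory.Sequence CategoryTheory Abelian Pointwise

section FiniteLength

variable {S : Type u} [CommRing S] [IsLocalRing S] [IsNoetherianRing S]

/-- In a prime filtration every factor is the residue field, whose projective dimension is the
length of the regular sequence generating the maximal ideal; extensions preserve the bound. -/
theorem hasProjectiveDimensionLT_of_pow_le_annihilator {rs : List S} (hrs : IsWeaklyRegular S rs)
    (hm : Ideal.ofList rs = maximalIdeal S) (Q : Type u) [AddCommGroup Q] [Module S Q]
    [Module.Finite S Q] {k : ℕ} (hk : maximalIdeal S ^ k ≤ Module.annihilator S Q) :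
    HasProjectiveDimensionLT (ModuleCat.of S Q) (rs.length + 1) := by
  revert hk
  induction ‹Module.Finite S Q› using
    IsNoetherianRing.induction_on_isQuotientEquivQuotientPrime S with
  | subsingleton N =>
    intro _
    have := (ModuleCat.isZero_of_subsingleton (ModuleCat.of S N)).hasProjectiveDimensionLT_zero
    exact hasProjectiveDimensionLT_of_ge _ 0 _ (Nat.zero_le _)
  | quotient N p e =>
    intro hk
    have hp : p.1 = maximalIdeal S := by
      refine le_antisymm (le_maximalIdeal p.2.ne_top) ?_
      refine p.2.le_of_pow_le (n := k) ?_
      rwa [e.annihilator_eq, Ideal.annihilator_quotient] at hk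
    have hreg : IsRegular S rs := ⟨hrs, by
      rw [smul_eq_mul, Ideal.mul_top, hm]
      exact (maximalIdeal.isMaximal S).ne_top.symm⟩
    have hpd := ModuleCat.projectiveDimension_quotient_eq_length rs hreg
    have e' : N ≃ₗ[S] Shrink.{u} (S ⧸ Ideal.ofList rs) :=
      e.trans ((Submodule.quotEquivOfEq _ _ (hp.trans hm.symm)).trans (Shrink.linearEquiv S _).symm)
    have h2 : projectiveDimension (ModuleCat.of S N) ≤ rs.length := by
      rw [projectiveDimension_eq_of_iso e'.toModuleIso, hpd]
    exact (projectiveDimension_le_iff _ _).1 h2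
  | exact N₁ N₂ N₃ f g hf hg hfg h₁ h₃ =>
    intro hk
    exact (shortExact_of_linearMap f g hfg hf hg).hasProjectiveDimensionLT_X₂ _
      (h₁ (hk.trans (LinearMap.annihilator_le_of_injective f hf)))
      (h₃ (hk.trans (LinearMap.annihilator_le_of_surjective g hg)))

end FiniteLength

section MCM

variable {S A : Type u} [CommRing S] [CommRing A] [Algebra S A]

/-- In the Artinian quotient some `y ^ n` is a multiple `y ^ (n + 1) * z`; as `y * z - 1` is a unit,
`y ^ n` vanishes there. -/
theorem exists_pow_mem_map_maximalIdeal [IsLocalRing S] [IsLocalRing A] [Module.Finite S A] {y : A}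
    (hy : y ∈ maximalIdeal A) : ∃ m : ℕ, y ^ m ∈ (maximalIdeal S).map (algebraMap S A) := by
  have := isArtinianRing_quotient_map S A
  set b := Ideal.Quotient.mk ((maximalIdeal S).map (algebraMap S A)) y with hb
  obtain ⟨n, z, hz⟩ := IsArtinian.exists_pow_succ_smul_dvd b
    (1 : A ⧸ (maximalIdeal S).map (algebraMap S A))
  obtain ⟨z, rfl⟩ := Ideal.Quotient.mk_surjective z
  refine ⟨n, ?_⟩
  rw [smul_eq_mul, smul_eq_mul, mul_one, hb, ← map_pow, ← map_pow, ← map_mul, Ideal.Quotient.eq]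
    at hz
  have hu : IsUnit (y * z - 1) := by
    by_contra h
    have h1 : y * z - 1 ∈ maximalIdeal A := h
    have h2 := (Ideal.sub_mem _ (Ideal.mul_mem_right z _ hy) h1)
    rw [sub_sub_cancel] at h2
    exact (Ideal.ne_top_iff_one _).1 (maximalIdeal.isMaximal A).ne_top h2
  have h3 : y ^ n.succ * z - y ^ n = y ^ n * (y * z - 1) := by rw [Nat.succ_eq_add_one]; ring
  rw [h3] at hz
  obtain ⟨u, hu⟩ := hu
  have := Ideal.mul_mem_right (↑u⁻¹ : A) _ hz
  rwa [← hu, mul_assoc, Units.mul_inv, mul_one] at this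

/-- Undo the quotients one element at a time: each step lowers the bound by one. The sequence lies
in `A`, whereas projective dimension is taken over `S`. -/
theorem hasProjectiveDimensionLT_one_of_isWeaklyRegular [IsLocalRing S] [IsNoetherianRing S]
    [IsLocalRing A] [Module.Finite S A] (ys : List A) (hmem : ∀ y ∈ ys, y ∈ maximalIdeal A) (k : ℕ)
    (N : Type u) [AddCommGroup N] [Module S N] [Module A N] [IsScalarTower S A N]
    [Module.Finite S N] (hys : IsWeaklyRegular N ys)
    (h : HasProjectiveDimensionLT
      (ModuleCat.of S (N ⧸ (Ideal.ofList ys • ⊤ : Submodule A N))) (k + ys.length + 1)) :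
    HasProjectiveDimensionLT (ModuleCat.of S N) (k + 1) := by
  induction ys generalizing N k with
  | nil =>
    have e : (N ⧸ (Ideal.ofList ([] : List A) • ⊤ : Submodule A N)) ≃ₗ[A] N :=
      Submodule.quotEquivOfEqBot _ (by rw [Ideal.ofList_nil, Submodule.bot_smul])
    exact hasProjectiveDimensionLT_of_iso (e.restrictScalars S).toModuleIso _
  | cons y ys ih =>
    rw [isWeaklyRegular_cons_iff] at hys
    obtain ⟨m, hm⟩ := exists_pow_mem_map_maximalIdeal (S := S) (hmem y List.mem_cons_self)
    refine hasProjectiveDimensionLT_of_quotSMulTop hys.1 hm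
      (ih (fun z hz ↦ hmem z (List.mem_cons_of_mem _ hz)) (k + 1) (QuotSMulTop y N) hys.2 ?_)
    have e := Submodule.quotOfListConsSMulTopEquivQuotSMulTopInner N y ys
    rw [show k + 1 + ys.length + 1 = k + (y :: ys).length + 1 by simp; omega]
    exact hasProjectiveDimensionLT_of_iso (e.restrictScalars S).toModuleIso _

theorem free_of_hasProjectiveDimensionLT_one [IsLocalRing S] (N : Type u) [AddCommGroup N]
    [Module S N] [Module.Finite S N] (h : HasProjectiveDimensionLT (ModuleCat.of S N) 1) :
    Module.Free S N := by
  have h1 := projective_iff_hasProjectiveDimensionLT_one.2 h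
  have : Module.Projective S N := (IsProjective.iff_projective (R := S) (P := N)).2 h1
  exact Module.free_of_flat_of_isLocalRing

theorem supportDim_nonneg (Q : Type u) [AddCommGroup Q] [Module A Q] [Nontrivial Q] :
    0 ≤ Module.supportDim A Q := by
  obtain ⟨a, ha⟩ := WithBot.ne_bot_iff_exists.1 (Module.supportDim_ne_bot_of_nontrivial A Q)
  rw [← ha]
  exact_mod_cast (zero_le : 0 ≤ a)

theorem exists_pow_le_annihilator_of_supportDim_le_zero [IsLocalRing S] [IsNoetherianRing S]
    [IsLocalRing A] [IsLocalHom (algebraMap S A)] (Q : Type u) [AddCommGroup Q] [Module S Q]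
    [Module A Q] [IsScalarTower S A Q] [Module.Finite A Q] [Nontrivial Q]
    (h : Module.supportDim A Q ≤ 0) : ∃ k, maximalIdeal S ^ k ≤ Module.annihilator S Q := by
  have h0 : Module.supportDim A Q = 0 := le_antisymm h (supportDim_nonneg Q)
  have h1 := support_of_supportDim_eq_zero A Q h0
  rw [Module.support_eq_zeroLocus, PrimeSpectrum.zeroLocus_eq_iff] at h1
  have h2 : maximalIdeal S ≤ (Module.annihilator S Q).radical := by
    intro s hs
    have h3 : algebraMap S A s ∈ (Module.annihilator A Q).radical := by
      rw [h1]
      exact Ideal.le_radical (map_nonunit (algebraMap S A) s hs)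
    obtain ⟨n, hn⟩ := h3
    refine ⟨n, ?_⟩
    rw [Module.mem_annihilator] at hn ⊢
    intro q
    rw [← hn q, ← map_pow, algebraMap_smul]
  exact Ideal.exists_pow_le_of_le_radical_of_fg h2 (IsNoetherian.noetherian _)

theorem isRegular_map_of_free [IsLocalRing S] [IsLocalRing A] [IsLocalHom (algebraMap S A)]
    {rs : List S} (hrs : IsWeaklyRegular S rs) (hm : ∀ r ∈ rs, r ∈ maximalIdeal S) (N : Type u)
    [AddCommGroup N] [Module S N] [Module A N] [IsScalarTower S A N] [Module.Finite A N]
    [Module.Free S N] [Nontrivial N] :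
    (∀ r ∈ rs.map (algebraMap S A), r ∈ maximalIdeal A) ∧
      IsRegular N (rs.map (algebraMap S A)) := by
  have hmem : ∀ r ∈ rs.map (algebraMap S A), r ∈ maximalIdeal A := by
    intro r hr
    obtain ⟨s, hs, rfl⟩ := List.mem_map.1 hr
    exact map_nonunit _ s (hm s hs)
  refine ⟨hmem, IsRegular.of_isWeaklyRegular_of_mem_maximalIdeal N hmem ?_⟩
  rw [isWeaklyRegular_map_algebraMap_iff]
  exact ((TensorProduct.rid S N).isWeaklyRegular_congr rs).1
    (hrs.isWeaklyRegular_lTensor (M₂ := N))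

/-- By freeness the sequence stays regular on `A`. Dividing by it leaves an Artinian ring, so its
length is the dimension. -/
theorem ringKrullDim_eq_length [IsLocalRing S] [IsLocalRing A] [IsNoetherianRing S]
    [IsLocalHom (algebraMap S A)] [Module.Finite S A] [Module.Free S A] {rs : List S}
    (hrs : IsWeaklyRegular S rs) (hm : Ideal.ofList rs = maximalIdeal S) :
    ringKrullDim A = rs.length := by
  have : IsNoetherianRing A := IsNoetherianRing.of_finite S A
  have hmem : ∀ r ∈ rs, r ∈ maximalIdeal S := fun r hr ↦ hm ▸ Ideal.subset_span hr
  obtain ⟨-, hreg⟩ := isRegular_map_of_free (A := A) hrs hmem A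
  have h := ringKrullDim_add_length_eq_ringKrullDim_of_isRegular _ hreg
  have hI : Ideal.ofList (rs.map (algebraMap S A)) = (maximalIdeal S).map (algebraMap S A) := by
    rw [← Ideal.map_ofList, hm]
  have := isArtinianRing_quotient_map S A
  have : Nontrivial (A ⧸ (maximalIdeal S).map (algebraMap S A)) :=
    Ideal.Quotient.nontrivial_iff.2 (map_maximalIdeal_lt_top (algebraMap S A)).ne
  rw [hI, ringKrullDimZero_iff_ringKrullDim_eq_zero.1 inferInstance, zero_add,
    List.length_map] at h
  exact h.symm

theorem length_le_of_isRegular [IsLocalRing A] [IsNoetherianRing A] {n : ℕ}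
    (hA : ringKrullDim A = n) (N : Type u) [AddCommGroup N] [Module A N] [Module.Finite A N]
    (ys : List A) (hys : IsRegular N ys) :
    Module.supportDim A (N ⧸ (Ideal.ofList ys • ⊤ : Submodule A N)) + ys.length ≤ n := by
  rw [Module.supportDim_add_length_eq_supportDim_of_isRegular ys hys, ← hA]
  exact Module.supportDim_le_ringKrullDim A N

/-- Regular sequences have length at most the dimension, so the supremum defining depth, when equal
to the dimension, is attained. -/
theorem moduleDepth_eq_iff [IsLocalRing A] [IsNoetherianRing A] {n : ℕ}
    (hA : ringKrullDim A = n) (N : Type u) [AddCommGroup N] [Module A N] [Module.Finite A N]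
    [Nontrivial N] :
    (moduleDepth A N : WithBot ℕ∞) = ringKrullDim A ↔
      ∃ ys : List A, (∀ y ∈ ys, y ∈ maximalIdeal A) ∧ IsRegular N ys ∧ ys.length = n := by
  have hle : ∀ ys : List A, IsRegular N ys → ys.length ≤ n := by
    intro ys hys
    have h1 := length_le_of_isRegular hA N ys hys
    have : Nontrivial (N ⧸ (Ideal.ofList ys • ⊤ : Submodule A N)) :=
      hys.quot_ofList_smul_nontrivial _
    have h2 := (add_le_add_left (supportDim_nonneg (A := A)
      (N ⧸ (Ideal.ofList ys • ⊤ : Submodule A N))) (ys.length : WithBot ℕ∞)).trans h1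
    rw [zero_add] at h2
    exact_mod_cast h2
  have hdepth : moduleDepth A N ≤ n :=
    iSup₂_le fun ys hys ↦ by exact_mod_cast hle ys hys.2
  rw [hA]
  constructor
  · intro h
    have h' : moduleDepth A N = n := by exact_mod_cast h
    cases n with
    | zero => exact ⟨[], by simp, IsRegular.nil A N, rfl⟩
    | succ n =>
      have hlt : (n : ℕ∞) < moduleDepth A N := by
        rw [h']
        exact_mod_cast Nat.lt_succ_self n
      obtain ⟨ys, hys⟩ := lt_iSup_iff.1 hlt
      obtain ⟨hys', hlen⟩ := lt_iSup_iff.1 hys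
      refine ⟨ys, hys'.1, hys'.2, le_antisymm (hle ys hys'.2) ?_⟩
      exact_mod_cast hlen
  · rintro ⟨ys, hmem, hreg, hlen⟩
    have : moduleDepth A N = n := by
      refine le_antisymm hdepth ?_
      rw [← hlen]
      exact le_iSup₂_of_le ys ⟨hmem, hreg⟩ le_rfl
    rw [this]
    rfl

/-- Over a local ring that is finite and free over a regular local ring, the maximal Cohen-Macaulay
modules are the nonzero modules that are finite and free over the regular local ring. -/
theorem isMCM_iff [IsRegularLocalRing S] [IsLocalRing A] [IsLocalHom (algebraMap S A)]
    [Module.Finite S A] [Module.Free S A] (N : Type u) [AddCommGroup N] [Module S N] [Module A N]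
    [IsScalarTower S A N] :
    IsMCM A N ↔ Module.Finite S N ∧ Nontrivial N ∧ Module.Free S N := by
  have : IsNoetherianRing A := IsNoetherianRing.of_finite S A
  obtain ⟨-, rs, hrs, hm⟩ := isDomain_and_exists_isWeaklyRegular S
  have hdim := ringKrullDim_eq_length (A := A) hrs hm
  have hmem : ∀ r ∈ rs, r ∈ maximalIdeal S := fun r hr ↦ hm ▸ Ideal.subset_span hr
  constructor
  · rintro ⟨hfin, hnt, hdepth⟩
    have hfinS : Module.Finite S N := Module.Finite.trans A N
    refine ⟨hfinS, hnt, ?_⟩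
    obtain ⟨ys, hys, hreg, hlen⟩ := (moduleDepth_eq_iff hdim N).1 hdepth
    apply free_of_hasProjectiveDimensionLT_one
    refine hasProjectiveDimensionLT_one_of_isWeaklyRegular (S := S) ys hys 0 N hreg.1 ?_
    have hle := length_le_of_isRegular hdim N ys hreg
    rw [hlen] at hle
    have hQ : Module.supportDim A (N ⧸ (Ideal.ofList ys • ⊤ : Submodule A N)) ≤ 0 := by
      refine ENat.WithBot.add_le_add_natCast_right_iff (c := rs.length) |>.1 ?_
      rwa [zero_add]
    have : Nontrivial (N ⧸ (Ideal.ofList ys • ⊤ : Submodule A N)) :=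
      hreg.quot_ofList_smul_nontrivial _
    obtain ⟨k, hk⟩ := exists_pow_le_annihilator_of_supportDim_le_zero (S := S) (A := A) _ hQ
    have : Module.Finite S (N ⧸ (Ideal.ofList ys • ⊤ : Submodule A N)) :=
      Module.Finite.trans A _
    -- Over `S`, the finite length quotient has projective dimension at most `rs.length`. The
    -- sequence `ys` has exactly that length, so undoing it leaves projective dimension zero.
    rw [zero_add, hlen]
    exact hasProjectiveDimensionLT_of_pow_le_annihilator hrs hm _ hk
  · rintro ⟨hfin, hnt, hfree⟩
    have hfinA : Module.Finite A N := Module.Finite.of_restrictScalars_finite S A N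
    refine ⟨hfinA, hnt, (moduleDepth_eq_iff hdim N).2 ?_⟩
    obtain ⟨h1, h2⟩ := isRegular_map_of_free (A := A) hrs hmem N
    exact ⟨_, h1, h2, List.length_map _⟩

end MCM

end

/-! ## Modules over an extension generated by a root -/

section

open IsLocalRing CategoryTheory Limits

section RootExtension

/-- `A` is generated over `S` by a root `z` of `X ^ d + f`, and is universal with this property. -/
structure IsRootExtension {S A : Type u} [CommRing S] [CommRing A] [Algebra S A] (d : ℕ) (f : S)
    (z : A) : Prop where
  pow_eq : z ^ d = -algebraMap S A f
  adjoin_eq_top : Algebra.adjoin S {z} = ⊤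
  exists_algHom : ∀ (N : Type u) [AddCommGroup N] [Module S N] (φ : Module.End S N),
    φ ^ d = -(f • 1) → ∃ ρ : A →ₐ[S] Module.End S N, ρ z = φ

variable {S A : Type u} [CommRing S] [CommRing A] [Algebra S A] {d : ℕ} {f : S} {z : A}

namespace IsRootExtension

theorem map_smul_of_map_root_smul (h : IsRootExtension d f z) {N N' : Type u} [AddCommGroup N]
    [Module S N] [Module A N] [IsScalarTower S A N] [AddCommGroup N'] [Module S N'] [Module A N']
    [IsScalarTower S A N'] (g : N →ₗ[S] N') (hg : ∀ x, g (z • x) = z • g x) (a : A) (x : N) :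
    g (a • x) = a • g x := by
  have ha : a ∈ Algebra.adjoin S {z} := h.adjoin_eq_top ▸ trivial
  induction ha using Algebra.adjoin_induction generalizing x with
  | mem a ha =>
    obtain rfl := ha
    exact hg x
  | algebraMap s => rw [algebraMap_smul, algebraMap_smul, map_smul]
  | add a b _ _ ha hb => rw [add_smul, add_smul, map_add, ha, hb]
  | mul a b _ _ ha hb => rw [mul_smul, mul_smul, ha, hb]

/-- The diagram of an `A`-module that is finite and free over `S`. -/
def rep (h : IsRootExtension d f z) {μ : S} (hμ : μ ^ d = -1) (N : Type u) [AddCommGroup N]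
    [Module S N] [Module A N] [IsScalarTower S A N] [Module.Finite S N] [Module.Free S N] :
    CycRep S (id : Unit → Unit) d f where
  F _ := N
  φ _ := μ • Algebra.lsmul S S N z
  pow_eq x j := by
    -- The factor `μ` corrects the sign: `z ^ d = -f` becomes `(μ z) ^ d = f`.
    refine (CycRep.totalMap_const_pow (M := N) (μ • Algebra.lsmul S S N z) id d x j).trans ?_
    rw [Function.iterate_id, smul_pow, ← map_pow, h.pow_eq, hμ]
    simp

variable {μ : S}

theorem eq_of_smul_root_eq (hμ : μ ^ d = -1) (hd : d ≠ 0) (N : Type u) [AddCommGroup N]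
    [Module S N] {x y : N}
    (hxy : μ • x = μ • y) : x = y := by
  have hu : IsUnit μ := by
    refine (isUnit_pow_iff hd).1 ?_
    rw [hμ]
    exact isUnit_one.neg
  exact hu.smul_left_cancel.1 hxy

theorem nonempty_linearEquiv_iff (h : IsRootExtension d f z) (hμ : μ ^ d = -1)
    (hd : d ≠ 0) (N N' : Type u) [AddCommGroup N]
    [Module S N] [Module A N] [IsScalarTower S A N] [Module.Finite S N] [Module.Free S N]
    [AddCommGroup N'] [Module S N'] [Module A N'] [IsScalarTower S A N'] [Module.Finite S N']
    [Module.Free S N'] :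
    Nonempty (N ≃ₗ[A] N') ↔ Nonempty (h.rep hμ N ≅ h.rep hμ N') := by
  constructor
  · rintro ⟨e⟩
    exact ⟨CycRep.isoMk (fun _ ↦ e.restrictScalars S) fun j (x : N) ↦ by
      change (e.restrictScalars S) (μ • z • x) = μ • z • (e.restrictScalars S) x
      rw [map_smul]
      exact congrArg (μ • ·) (map_smul e z x)⟩
  · rintro ⟨i⟩
    let e : N ≃ₗ[S] N' := CycRep.isoComponent i ()
    have he : ∀ x : N, e (z • x) = z • e x := fun x ↦ by
      apply eq_of_smul_root_eq hμ hd
      rw [← map_smul]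
      exact i.hom.2 () x
    exact ⟨{ e with map_smul' := h.map_smul_of_map_root_smul e.toLinearMap he }⟩

/-- The inverse `ν` of `μ` also satisfies `ν ^ d = -1`, so `ν • g` satisfies the equation of `z`,
and the universal property makes `z` act by it. -/
theorem exists_module (h : IsRootExtension d f z) (hμ : μ ^ d = -1) (hd : d ≠ 0) {N : Type u}
    [AddCommGroup N] [Module S N] (g : Module.End S N) (hg : ∀ x, (g ^ d) x = f • x) :
    ∃ (_ : Module A N) (_ : IsScalarTower S A N), ∀ x : N, g x = μ • z • x := by
  have hu : IsUnit μ := by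
    refine (isUnit_pow_iff hd).1 ?_
    rw [hμ]
    exact isUnit_one.neg
  obtain ⟨ν, hν⟩ := hu.exists_right_inv
  have hν' : ν ^ d = -1 := by
    have := congrArg (· ^ d) hν
    simp only [mul_pow, hμ, one_pow] at this
    linear_combination -this
  obtain ⟨ρ, hρ⟩ := h.exists_algHom N (ν • g) (by
    ext x
    rw [smul_pow, hν', LinearMap.smul_apply, hg]
    simp)
  let M : Module A N := Module.compHom N ρ.toRingHom
  have hsmul : ∀ (a : A) (x : N), a • x = ρ a x := fun _ _ ↦ rfl
  refine ⟨M, ⟨fun s a x ↦ ?_⟩, fun x ↦ ?_⟩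
  · rw [hsmul, hsmul, map_smul, LinearMap.smul_apply]
  · rw [hsmul, hρ, LinearMap.smul_apply, smul_smul, hν, one_smul]

theorem rep_prod_iso (h : IsRootExtension d f z) (hμ : μ ^ d = -1)
    (N₁ N₂ : Type u) [AddCommGroup N₁] [Module S N₁] [Module A N₁]
    [IsScalarTower S A N₁] [Module.Finite S N₁] [Module.Free S N₁] [AddCommGroup N₂] [Module S N₂]
    [Module A N₂] [IsScalarTower S A N₂] [Module.Finite S N₂] [Module.Free S N₂] :
    Nonempty (h.rep hμ (N₁ × N₂) ≅ (h.rep hμ N₁).prod (h.rep hμ N₂)) :=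
  ⟨CycRep.isoMk (fun _ ↦ LinearEquiv.refl S (N₁ × N₂)) fun _ _ ↦ rfl⟩

theorem not_isZero_rep_iff (h : IsRootExtension d f z) (hμ : μ ^ d = -1)
    (N : Type u) [AddCommGroup N]
    [Module S N] [Module A N] [IsScalarTower S A N] [Module.Finite S N] [Module.Free S N] :
    ¬ IsZero (h.rep hμ N) ↔ Nontrivial N := by
  rw [CycRep.not_isZero_iff]
  exact ⟨fun ⟨_, h⟩ ↦ h, fun h ↦ ⟨(), h⟩⟩

theorem exists_rep_iso (h : IsRootExtension d f z) (hμ : μ ^ d = -1)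
    (hd : d ≠ 0) (X : CycRep S (id : Unit → Unit) d f) :
    ∃ (N : Type u) (_ : AddCommGroup N) (_ : Module S N) (_ : Module A N)
      (_ : IsScalarTower S A N) (_ : Module.Finite S N) (_ : Module.Free S N),
      Nonempty (X ≅ h.rep hμ N) := by
  obtain ⟨M, hM, hz⟩ := h.exists_module hμ hd (N := X.F ()) (X.φ ()) X.unit_pow_eq
  exact ⟨X.F (), inferInstance, inferInstance, M, hM, inferInstance, inferInstance,
    ⟨CycRep.isoMk (fun _ ↦ LinearEquiv.refl S (X.F ())) fun _ x ↦ hz x⟩⟩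

theorem isScalarTower_compHom (N : Type u) [AddCommGroup N] [Module A N] :
    let := Module.compHom N (algebraMap S A)
    IsScalarTower S A N :=
  letI := Module.compHom N (algebraMap S A)
  ⟨fun s a x ↦ by
    rw [Algebra.smul_def, mul_smul]
    rfl⟩

variable [IsRegularLocalRing S] [IsLocalRing A] [IsLocalHom (algebraMap S A)] [Module.Finite S A]
  [Module.Free S A]

/-- Being finite and free over `S` is the only condition on a nonzero summand on either side, so
direct sum decompositions of the module and of its diagram correspond. -/
theorem isIndecomposableMCM_iff (h : IsRootExtension d f z) (hμ : μ ^ d = -1)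
    (hd : d ≠ 0) (N : Type u) [AddCommGroup N]
    [Module S N] [Module A N] [IsScalarTower S A N] [Module.Finite S N] [Module.Free S N] :
    IsIndecomposableMCM A N ↔ KrullSchmidt.IsIndec (h.rep hμ N) := by
  rw [CycRep.isIndec_iff, IsIndecomposableMCM, isMCM_iff (S := S) N, h.not_isZero_rep_iff hμ]
  refine and_congr ⟨fun h ↦ h.2.1, fun h ↦ ⟨inferInstance, h, inferInstance⟩⟩
    ⟨fun H X Y hX hY ↦ ⟨fun i ↦ ?_⟩, fun H N₁ N₂ _ _ _ _ h₁ h₂ ↦ ⟨fun e ↦ ?_⟩⟩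
  · obtain ⟨N₁, _, _, _, _, _, _, ⟨i₁⟩⟩ := h.exists_rep_iso hμ hd X
    obtain ⟨N₂, _, _, _, _, _, _, ⟨i₂⟩⟩ := h.exists_rep_iso hμ hd Y
    have hn₁ : Nontrivial N₁ := (h.not_isZero_rep_iff hμ N₁).1 fun hz ↦ hX (hz.of_iso i₁)
    have hn₂ : Nontrivial N₂ := (h.not_isZero_rep_iff hμ N₂).1 fun hz ↦ hY (hz.of_iso i₂)
    refine (H N₁ N₂ ((isMCM_iff (S := S) N₁).2 ⟨inferInstance, hn₁, inferInstance⟩)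
      ((isMCM_iff (S := S) N₂).2 ⟨inferInstance, hn₂, inferInstance⟩)).false
      ((h.nonempty_linearEquiv_iff hμ hd N (N₁ × N₂)).2
        ⟨i ≪≫ CycRep.prodIso i₁ i₂ ≪≫ (h.rep_prod_iso hμ N₁ N₂).some.symm⟩).some
  · let : Module S N₁ := Module.compHom N₁ (algebraMap S A)
    let : Module S N₂ := Module.compHom N₂ (algebraMap S A)
    have : IsScalarTower S A N₁ := isScalarTower_compHom N₁
    have : IsScalarTower S A N₂ := isScalarTower_compHom N₂
    obtain ⟨_, hn₁, _⟩ := (isMCM_iff (S := S) N₁).1 h₁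
    obtain ⟨_, hn₂, _⟩ := (isMCM_iff (S := S) N₂).1 h₂
    exact (H (h.rep hμ N₁) (h.rep hμ N₂) ((h.not_isZero_rep_iff hμ N₁).2 hn₁)
      ((h.not_isZero_rep_iff hμ N₂).2 hn₂)).false
      (((h.nonempty_linearEquiv_iff hμ hd N (N₁ × N₂)).1 ⟨e⟩).some ≪≫
        (h.rep_prod_iso hμ N₁ N₂).some)

theorem hasFiniteCMType_iff (h : IsRootExtension d f z) (hμ : μ ^ d = -1)
    (hd : d ≠ 0) :
    HasFiniteCMType A ↔ KrullSchmidt.FiniteType (CycRep S (id : Unit → Unit) d f) := by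
  rw [KrullSchmidt.finiteType_iff_exists_fin]
  constructor
  · rintro ⟨n, M, hM, H⟩
    let : ∀ i, Module S (M i) := fun i ↦ Module.compHom (M i) (algebraMap S A)
    have : ∀ i, IsScalarTower S A (M i) := fun i ↦ isScalarTower_compHom (M i)
    have hfree := fun i ↦ (isMCM_iff (S := S) (M i)).1 (hM i).1
    have : ∀ i, Module.Finite S (M i) := fun i ↦ (hfree i).1
    have : ∀ i, Module.Free S (M i) := fun i ↦ (hfree i).2.2
    refine ⟨n, fun i ↦ h.rep hμ (M i), fun i ↦ (h.isIndecomposableMCM_iff hμ hd (M i)).1 (hM i),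
      fun Y hY ↦ ?_⟩
    obtain ⟨N, _, _, _, _, _, _, ⟨e⟩⟩ := h.exists_rep_iso hμ hd Y
    obtain ⟨i, hi⟩ := H N ((h.isIndecomposableMCM_iff hμ hd N).2 (hY.of_iso e))
    exact ⟨i, ⟨e ≪≫ ((h.nonempty_linearEquiv_iff hμ hd N (M i)).1 hi).some⟩⟩
  · rintro ⟨n, X, hX, H⟩
    choose N i₁ i₂ i₃ i₄ i₅ i₆ e using fun i ↦ h.exists_rep_iso hμ hd (X i)
    refine ⟨n, fun i ↦ ModuleCat.of A (N i), fun i ↦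
      (h.isIndecomposableMCM_iff hμ hd (N i)).2 ((hX i).of_iso (e i).some), fun N' _ _ hN' ↦ ?_⟩
    let : Module S N' := Module.compHom N' (algebraMap S A)
    have : IsScalarTower S A N' := isScalarTower_compHom N'
    obtain ⟨_, _, _⟩ := (isMCM_iff (S := S) N').1 hN'.1
    obtain ⟨i, ⟨j⟩⟩ := H (h.rep hμ N') ((h.isIndecomposableMCM_iff hμ hd N').1 hN')
    exact ⟨i, (h.nonempty_linearEquiv_iff hμ hd N' (N i)).2 ⟨j ≪≫ (e i).some⟩⟩

end IsRootExtension

end RootExtension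

end

/-! ## The branched cover -/

section

open IsLocalRing

section BranchedCover

open Polynomial in
theorem isDistinguishedAt_X_pow_add_C {S : Type u} [CommRing S] [Nontrivial S] {I : Ideal S} {d : ℕ}
    (hd : d ≠ 0) {f : S} (hf : f ∈ I) : (X ^ d + C f : S[X]).IsDistinguishedAt I where
  mem {n} hn := by
    rw [natDegree_X_pow_add_C] at hn
    rw [coeff_add, coeff_X_pow, if_neg hn.ne, zero_add, coeff_C]
    split_ifs
    · exact hf
    · exact zero_mem _
  monic := monic_X_pow_add_C f hd

variable {S : Type u} [CommRing S] [IsLocalRing S] [IsAdicComplete (maximalIdeal S) S] {d : ℕ}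
  {f : S}

/-- By the Weierstrass division theorem, the branched cover is obtained by adjoining a root of
`X ^ d + f`. -/
theorem exists_algEquiv_branchedCover (hd : d ≠ 0) (hf : f ∈ maximalIdeal S) :
    ∃ e : AdjoinRoot (Polynomial.X ^ d + Polynomial.C f) ≃ₐ[S] BranchedCover d f,
      e (AdjoinRoot.root _) = Ideal.Quotient.mk _ PowerSeries.X := by
  have hdist := isDistinguishedAt_X_pow_add_C hd hf
  have hI : Ideal.span {((Polynomial.X ^ d + Polynomial.C f : Polynomial S) : PowerSeries S)} =
      Ideal.span {PowerSeries.C f + PowerSeries.X ^ d} := by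
    simp [add_comm]
  refine ⟨hdist.algEquivQuotient.trans (Ideal.quotientEquivAlgOfEq S hI), ?_⟩
  have h1 : hdist.algEquivQuotient (Ideal.Quotient.mk _ Polynomial.X) =
      Ideal.Quotient.mk _ ((Polynomial.X : Polynomial S) : PowerSeries S) := by
    rw [Polynomial.IsDistinguishedAt.algEquivQuotient_apply]
    rfl
  change Ideal.quotientEquivAlgOfEq S hI
    (hdist.algEquivQuotient (Ideal.Quotient.mk _ Polynomial.X)) = _
  rw [h1, Ideal.quotientEquivAlgOfEq_mk, Polynomial.coe_X]

theorem finite_branchedCover (hd : d ≠ 0) (hf : f ∈ maximalIdeal S) :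
    Module.Finite S (BranchedCover d f) := by
  obtain ⟨e, -⟩ := exists_algEquiv_branchedCover hd hf
  have := (Polynomial.monic_X_pow_add_C f hd).finite_adjoinRoot
  exact Module.Finite.equiv e.toLinearEquiv

theorem free_branchedCover (hd : d ≠ 0) (hf : f ∈ maximalIdeal S) :
    Module.Free S (BranchedCover d f) := by
  obtain ⟨e, -⟩ := exists_algEquiv_branchedCover hd hf
  have := (Polynomial.monic_X_pow_add_C f hd).free_adjoinRoot
  exact Module.Free.of_equiv e.toLinearEquiv

theorem isRootExtension_branchedCover (hd : d ≠ 0) (hf : f ∈ maximalIdeal S) :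
    IsRootExtension d f (Ideal.Quotient.mk _ PowerSeries.X : BranchedCover d f) := by
  obtain ⟨e, he⟩ := exists_algEquiv_branchedCover hd hf
  rw [← he]
  refine ⟨?_, ?_, fun N _ _ φ hφ ↦ ?_⟩
  · have h := AdjoinRoot.eval₂_root (Polynomial.X ^ d + Polynomial.C f)
    rw [Polynomial.eval₂_add, Polynomial.eval₂_X_pow, Polynomial.eval₂_C] at h
    rw [← map_pow, eq_neg_of_add_eq_zero_left h, map_neg, ← AdjoinRoot.algebraMap_eq, e.commutes]
  · have h := congrArg (Subalgebra.map (e : AdjoinRoot (Polynomial.X ^ d + Polynomial.C f) →ₐ[S]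
      BranchedCover d f)) (AdjoinRoot.adjoinRoot_eq_top
        (f := Polynomial.X ^ d + Polynomial.C f))
    rw [AlgHom.map_adjoin, Set.image_singleton, Algebra.map_top,
      (AlgHom.range_eq_top _).2 e.surjective] at h
    exact h
  · let ρ : AdjoinRoot (Polynomial.X ^ d + Polynomial.C f) →ₐ[S] Module.End S N :=
      Ideal.Quotient.liftₐ _ (Polynomial.aeval φ) (by
        intro a ha
        obtain ⟨b, rfl⟩ := Ideal.mem_span_singleton'.1 ha
        rw [map_mul, map_add, map_pow, Polynomial.aeval_X, Polynomial.aeval_C, hφ,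
          Algebra.algebraMap_eq_smul_one, neg_add_cancel, mul_zero])
    refine ⟨ρ.comp e.symm.toAlgHom, ?_⟩
    have h1 : ρ (AdjoinRoot.root _) = φ := by
      change Polynomial.aeval φ Polynomial.X = φ
      exact Polynomial.aeval_X φ
    simpa using h1

/-- A root in the algebraically closed residue field is simple, since it and `d` are nonzero there,
so Hensel's lemma lifts it. -/
theorem exists_pow_eq_neg_one [IsAlgClosed (ResidueField S)] (hd : d ≠ 0)
    (hchar : (d : ResidueField S) ≠ 0) : ∃ μ : S, μ ^ d = -1 := by
  obtain ⟨x, hx⟩ := IsAlgClosed.exists_pow_nat_eq (-1 : ResidueField S) (Nat.pos_of_ne_zero hd)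
  have hx0 : x ≠ 0 := by
    rintro rfl
    rw [zero_pow hd] at hx
    exact one_ne_zero (neg_eq_zero.1 hx.symm)
  obtain ⟨a, rfl⟩ := residue_surjective x
  obtain ⟨μ, hμ, -⟩ := HenselianRing.is_henselian (I := maximalIdeal S)
    (Polynomial.X ^ d + Polynomial.C 1) (Polynomial.monic_X_pow_add_C 1 hd) a
    (by
      rw [← residue_eq_zero_iff]
      simp [hx])
    (by
      have h : residue S ((Polynomial.X ^ d + Polynomial.C (1 : S)).derivative.eval a) =
          d * residue S a ^ (d - 1) := by simp [Polynomial.derivative_X_pow]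
      exact IsUnit.mk0 (residue S _) (h ▸ mul_ne_zero hchar (pow_ne_zero _ hx0)))
  refine ⟨μ, ?_⟩
  have h : μ ^ d + 1 = 0 := by simpa using hμ
  exact eq_neg_of_add_eq_zero_left h

end BranchedCover

end

/-! ### The main theorem -/

theorem theoremA {S : Type u} [CommRing S] [IsRegularLocalRing S]
    [IsAdicComplete (maximalIdeal S) S] [IsAlgClosed (ResidueField S)]
    {d : ℕ} (hd : 2 ≤ d) (hchar : ¬ ringChar (ResidueField S) ∣ d)
    {f : S} (hf0 : f ≠ 0) (hf : f ∈ maximalIdeal S ^ 2) :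
    haveI : IsLocalRing (BranchedCover d f) := branchedCover_isLocalRing hd hf
    HasFiniteMFType d f ↔ HasFiniteCMType (BranchedCover d f) := by
  have hloc : IsLocalRing (BranchedCover d f) := branchedCover_isLocalRing hd hf
  have hd0 : d ≠ 0 := by omega
  have hfm : f ∈ maximalIdeal S := Ideal.pow_le_self two_ne_zero hf
  have : NeZero d := ⟨hd0⟩
  have : IsDomain S := (isDomain_and_exists_isWeaklyRegular S).1
  have := finite_branchedCover hd0 hfm
  have := free_branchedCover hd0 hfm
  -- The branched cover is a faithful integral extension of `S`, so units are detected in `S`.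
  have : IsLocalHom (algebraMap S (BranchedCover d f)) := by
    have : FaithfulSMul S (BranchedCover d f) := inferInstance
    have : Algebra.IsIntegral S (BranchedCover d f) := inferInstance
    infer_instance
  have hd1 : (d : ResidueField S) ≠ 0 := fun h ↦ hchar (ringChar.dvd h)
  have hcard : IsUnit ((Fintype.card (ZMod d) : ℕ) : S) := by
    rw [ZMod.card, ← isUnit_map_iff (residue S), map_natCast]
    exact hd1.isUnit
  obtain ⟨μ, hμ⟩ := exists_pow_eq_neg_one (S := S) hd0 hd1
  rw [MatFac.hasFiniteMFType_iff hf0,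
    (isRootExtension_branchedCover hd0 hfm).hasFiniteCMType_iff hμ hd0]
  -- The shift by `1` on `ZMod d` is a bijection whose `d`-th iterate is the identity.
  refine CycRep.finiteType_iff (fun j ↦ ?_) ⟨add_left_injective 1, add_right_surjective 1⟩ hcard
  rw [show (fun i : ZMod d ↦ i + 1) = (· + 1) from rfl, add_right_iterate_apply]
  simp
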